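/- For complex $\nu$ and $z>0$ let $I_\nu(z)=\sum_{k\ge 0}\frac{(z/2)^{2k+\nu}}{k!\,\Gamma(k+\nu+1)}$ be the modified Bessel function of the first kind and $K_\nu(z)=\frac{\pi}{2\sin(\pi\nu)}\,[I_{-\nu}(z)-I_\nu(z)]$ (the limiting value being taken when $\nu$ is an integer) the Macdonald function. For a complex-valued function $g$ on $\mathbb{R}$ put $$(Gg)(x)=\sqrt{\pi}\,e^{-x/2}\int_{-\infty}^{\infty}\mathrm{Re}\left[I_{i\tau}\left(\frac{x}{2}\right)\right]\frac{g(\tau)}{\cosh(\pi\tau)}\,d\tau,\qquad x>0.$$ Let $C(\mathbb{R}_+)$ be the space of bounded continuous complex-valued functions on $\mathbb{R}_+=(0,\infty)$ with the supremum norm, and, for $\nu\in\mathbb{R}$, let $L_{\nu,1}(\mathbb{R}_+)$ be the space of measurable $f$ on $\mathbb{R}_+$ with $\int_0^\infty |f(x)|\,x^{\nu-1}\,dx<\infty$. Theorem 3. For every $g\in L_1(\mathbb{R};[\cosh(\pi\tau)]^{-1/2}d\tau)$ the integral defining $(Gg)(x)$ converges absolutely for all $x>0$, and $G$ is a bounded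 linear operator $$G: L_1(\mathbb{R};[\cosh(\pi\tau)]^{-1/2}d\tau)\to C(\mathbb{R}_+),\qquad \|Gg\|_{C(\mathbb{R}_+)}\le\sqrt{\pi}\,\|g\|_{L_1(\mathbb{R};[\cosh(\pi\tau)]^{-1/2}d\tau)}.$$ Moreover, if $g\in L_1(\mathbb{R};[\cosh(\pi\tau)]^{-1/2}d\tau)$ and $Gg\in L_{\nu,1}(\mathbb{R}_+)$ for some $\nu$ with $0<\nu<1/2$, then for all $x>0$ $$\int_0^\infty\frac{(Gg)(t)}{x+t}\,dt=\sqrt{\pi}\,e^{x/2}\int_{-\infty}^{\infty}K_{i\tau}\left(\frac{x}{2}\right)\frac{g(\tau)}{\cosh(\pi\tau)}\,d\tau,$$ where both integrals converge absolutely. -/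

import Mathlib

open MeasureTheory Set Filter Topology
open scoped BoundedContinuousFunction

noncomputable section

/-- The modified Bessel function of the first kind
`I_ν(z) = ∑ₖ (z/2)^(2k+ν) / (k! Γ(k+ν+1))`, with the principal branch of the power. (At the poles
of `Γ` the coefficient `1/Γ` is `0`, which is also what Mathlib's conventions give.) -/
def besselI (ν z : ℂ) : ℂ :=
  ∑' k : ℕ, (z / 2) ^ (2 * (k : ℂ) + ν) /
    ((Nat.factorial k : ℂ) * Complex.Gamma ((k : ℂ) + ν + 1))

/-- The quotient `π / (2 sin (πν)) * (I_{-ν}(z) - I_ν(z))`, meaningful for non-integer `ν`. -/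
def besselKQuot (ν z : ℂ) : ℂ :=
  (Real.pi : ℂ) / (2 * Complex.sin ((Real.pi : ℂ) * ν)) * (besselI (-ν) z - besselI ν z)

open scoped Classical in
/-- The Macdonald function (modified Bessel function of the second kind) `K_ν(z)`, equal to
`π / (2 sin (πν)) * (I_{-ν}(z) - I_ν(z))` for non-integer `ν`, and to the limit of this expression
in the index when `ν` is an integer. -/
def besselK (ν z : ℂ) : ℂ :=
  if Complex.sin ((Real.pi : ℂ) * ν) = 0 then limUnder (𝓝[≠] ν) (fun μ : ℂ => besselKQuot μ z)
  else besselKQuot ν z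

/-- The integrand `Re[I_{iτ}(x/2)] g(τ) / cosh(πτ)` of the index transform. -/
def indexIntegrand (g : ℝ → ℂ) (x τ : ℝ) : ℂ :=
  ((besselI (Complex.I * (τ : ℂ)) ((x / 2 : ℝ) : ℂ)).re : ℂ) * g τ /
    ((Real.cosh (Real.pi * τ) : ℝ) : ℂ)

/-- The index transform
`(Gg)(x) = √π e^{-x/2} ∫_ℝ Re[I_{iτ}(x/2)] g(τ) / cosh(πτ) dτ`. -/
def indexG (g : ℝ → ℂ) (x : ℝ) : ℂ :=
  ((Real.sqrt Real.pi * Real.exp (-x / 2) : ℝ) : ℂ) * ∫ τ : ℝ, indexIntegrand g x τ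

/-- The measure `cosh(πτ)^{-1/2} dτ` on `ℝ`. -/
def coshMeasure : Measure ℝ :=
  volume.withDensity (fun τ : ℝ => ENNReal.ofReal (Real.cosh (Real.pi * τ) ^ (-(1 / 2) : ℝ)))

/-- Membership in `L_{ν,p}(ℝ₊)`: `f` is measurable on `(0,∞)` and
`∫_0^∞ |f(x)|^p x^{νp-1} dx < ∞`. -/
def MemMellinLp (ν p : ℝ) (f : ℝ → ℂ) : Prop :=
  AEStronglyMeasurable f (volume.restrict (Ioi (0 : ℝ))) ∧
    IntegrableOn (fun x : ℝ => ‖f x‖ ^ p * x ^ (ν * p - 1)) (Ioi (0 : ℝ))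

/-- The integrand `K_{iτ}(x/2) g(τ) / cosh(πτ)`. -/
def macdonaldIntegrand (g : ℝ → ℂ) (x τ : ℝ) : ℂ :=
  besselK (Complex.I * (τ : ℂ)) ((x / 2 : ℝ) : ℂ) * g τ /
    ((Real.cosh (Real.pi * τ) : ℝ) : ℂ)

end

/-!
With `b(τ, t) = I_{iτ}(t)`, everything rests on two facts about `b`.

*Size.* Poisson's integral (`besselI_eq_poissonIntegral`), obtained term by term from beta
integrals, together with `|Γ(1/2 + iτ)|² = π / cosh(πτ)` gives
`|I_{iτ}(t)| ≤ √cosh(πτ) I₀(t)`. Since `I₀(t) ≤ eᵗ`, the kernel of `G` is bounded by `√π cosh(πτ)^(-1/2)`, which is the boundedness of the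
operator with the stated constant. The bound `e⁻ᵗ I₀(t) = O(t^(-1/4))` makes the double integral for
`∫ (Gg)(t) / (x + t) dt` absolutely convergent for every integrable `g`, so Fubini's theorem reduces
the Stieltjes formula to the kernel identity
`∫₀^∞ e⁻ᵗ Re I_{iτ}(t) / (z + t) dt = e^z K_{iτ}(z)` for `τ ≠ 0`.

*Laplace transform.* `∫₀^∞ e^(-t cosh u) I_{iτ}(t) dt = e^(-iτu) / sinh u`
(`integral_besselI_mul_exp`). Integrating the series term by term leads to the generating function
of `binom(2k + ν, k)`, evaluated in `hasSum_risingChoose_generating`. Writing `1 / (z + t)` as a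
Laplace integral, the real part of this formula turns the left side of the kernel identity into
`e^z ∫₀^∞ e^(-z cosh v) cos(τv) dv` (`integral_re_besselI_div_add`).

It remains to see that `∫₀^∞ e^(-z cosh v) cos(τv) dv` is the `K_{iτ}(z)` defined through
`I_{-iτ} - I_{iτ} = -2i Im I_{iτ}` (`macdonaldIntegral_eq`). Both sides have the Laplace
transform `π sin(τu) / (sinh(πτ) sinh u)` at `cosh u`: for one side this is the imaginary part of
the formula above, for the other it is the Fourier transform of `1 / (cosh u + cosh v)`
(`fourier_inv_cosh_add_cosh`). The Laplace transform is injective on continuous functions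
(`eqOn_zero_of_laplace_eq_zero`). The index `τ = 0`, where `K` is defined as a limit, is a null set
and plays no role.
-/

/-! ### The generating function of `binom(2k + ν, k)` -/

/-- `(a)ₖ / k!`, the coefficient of `xᵏ` in `(1 - x)⁻ᵃ`. -/
noncomputable def risingChoose (a : ℂ) (k : ℕ) : ℂ :=
  (ascPochhammer ℂ k).eval a / (k.factorial : ℂ)

theorem norm_ascPochhammer_eval_le {a : ℂ} {m : ℕ} (h : ‖a‖ ≤ m) (k : ℕ) :
    ‖(ascPochhammer ℂ k).eval a‖ ≤ (m.ascFactorial k : ℝ) := by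
  induction k with
  | zero => simp
  | succ k ih =>
    rw [ascPochhammer_succ_eval, norm_mul, Nat.ascFactorial_succ, mul_comm (m + k)]
    push_cast
    have : ‖a + (k : ℂ)‖ ≤ m + k := (norm_add_le _ _).trans (by simpa using h)
    gcongr

theorem norm_risingChoose_le {a : ℂ} {m : ℕ} (h : ‖a‖ ≤ (m + 1 : ℕ)) (k : ℕ) :
    ‖risingChoose a k‖ ≤ 2 ^ (m + k) := by
  have hk : (0 : ℝ) < k.factorial := by exact_mod_cast k.factorial_pos
  rw [risingChoose, norm_div, Complex.norm_natCast, div_le_iff₀ hk]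
  refine (norm_ascPochhammer_eval_le h k).trans ?_
  rw [Nat.ascFactorial_eq_factorial_mul_choose, mul_comm]
  exact_mod_cast Nat.mul_le_mul_right _ (Nat.choose_le_two_pow _ _)

theorem hasSum_risingChoose (a : ℂ) {x : ℂ} (hx : ‖x‖ < 1) :
    HasSum (fun k => risingChoose a k * x ^ k) ((1 - x) ^ (-a)) := by
  have h := (Complex.one_div_one_sub_cpow_hasFPowerSeriesOnBall_zero a).hasSum
    (y := x) (by simpa [enorm_eq_nnnorm, ← NNReal.coe_lt_coe] using hx)
  simp only [FormalMultilinearSeries.ofScalars_apply_eq, zero_add, smul_eq_mul] at h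
  rw [Complex.cpow_neg, ← one_div]
  convert h using 2 with k
  congr 1
  have h1 := Ring.factorial_nsmul_multichoose_eq_ascPochhammer a k
  rw [Polynomial.ascPochhammer_smeval_eq_eval, nsmul_eq_mul] at h1
  rw [risingChoose, ← h1, Ring.choose]
  have : (k.factorial : ℂ) ≠ 0 := by exact_mod_cast k.factorial_ne_zero
  rw [mul_div_cancel_left₀ _ this]
  congr 1
  ring_nf

/-- The coefficient identity behind the generating function of `risingChoose (k + ν + 1) k`:
up to the factor `n!`, the left side is the `n`-th difference of a monic polynomial of
degree `n`. -/
theorem sum_antidiagonal_risingChoose (ν : ℂ) (n : ℕ) :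
    ∑ p ∈ Finset.HasAntidiagonal.antidiagonal n, risingChoose (p.1 + ν + 1) p.1 *
      (risingChoose (2 * p.1 + ν + 1) p.2 * (-1) ^ p.2) = 1 := by
  have h := congrFun (Polynomial.fwdDiff_iter_degree_eq_factorial (ascPochhammer ℂ n)) (ν + 1)
  rw [fwdDiff_iter_eq_sum_shift, ascPochhammer_natDegree,
    (monic_ascPochhammer ℂ n).leadingCoeff] at h
  have hn : (n.factorial : ℂ) ≠ 0 := by exact_mod_cast n.factorial_ne_zero
  simp only [one_smul, Pi.natCast_apply] at h
  rw [Finset.Nat.sum_antidiagonal_eq_sum_range_succ_mk, ← mul_left_inj' hn, one_mul,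
    Finset.sum_mul]
  refine Eq.trans ?_ h
  refine Finset.sum_congr rfl fun k hk => ?_
  have hk' : k ≤ n := by simpa [Nat.lt_succ_iff] using hk
  obtain ⟨j, rfl⟩ := Nat.exists_eq_add_of_le hk'
  have e : (ascPochhammer ℂ (k + j)).eval (ν + 1 + k • (1 : ℂ)) =
      (ascPochhammer ℂ k).eval (k + ν + 1) * (ascPochhammer ℂ j).eval (2 * k + ν + 1) := by
    rw [← ascPochhammer_mul, Polynomial.eval_mul, Polynomial.eval_comp]
    congr 2
    · simp; ring
    · simp; ring
  have hc := Nat.add_choose_mul_factorial_mul_factorial k j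
  have hc' : ((k + j).choose k : ℂ) * k.factorial * j.factorial = (k + j).factorial := by
    rw [Nat.choose_symm_add]
    exact_mod_cast hc
  have h1 : (k.factorial : ℂ) ≠ 0 := by exact_mod_cast k.factorial_ne_zero
  have h2 : (j.factorial : ℂ) ≠ 0 := by exact_mod_cast j.factorial_ne_zero
  rw [e, zsmul_eq_mul]
  simp only [risingChoose, Nat.add_sub_cancel_left]
  push_cast
  rw [← hc']
  field_simp

/-- The double series obtained by expanding `(1 + w)^(-(2k + ν + 1))` converges absolutely for
small `w`, and may be summed along antidiagonals. -/
theorem hasSum_risingChoose_of_small (ν : ℂ) {w : ℝ} (h0 : 0 < w) (h1 : w < 1 / 16) :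
    HasSum (fun k : ℕ => risingChoose (k + ν + 1) k *
      ((w : ℂ) ^ k * (1 + (w : ℂ)) ^ (-(2 * k + ν + 1)))) (1 / (1 - (w : ℂ))) := by
  obtain ⟨M, hM⟩ := exists_nat_ge ‖ν‖
  set F : ℕ × ℕ → ℂ := fun p => risingChoose (p.1 + ν + 1) p.1 *
      (risingChoose (2 * p.1 + ν + 1) p.2 * (-1) ^ p.2) * (w : ℂ) ^ (p.1 + p.2) with hF
  have hw : ‖(w : ℂ)‖ = w := by simp [abs_of_pos h0]
  -- The two factors are binomial coefficients when `ν` is the natural number `M`, hence powers of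
  -- two; this is what forces `w < 1 / 16`.
  have hbound : ∀ p : ℕ × ℕ, ‖F p‖ ≤ 4 ^ M * ((16 * w) ^ p.1 * (2 * w) ^ p.2) := by
    rintro ⟨k, j⟩
    have e1 : ‖(k : ℂ) + ν + 1‖ ≤ ((k + M + 1 : ℕ) : ℝ) := by
      refine (norm_add_le _ _).trans ?_
      have := norm_add_le (k : ℂ) ν
      simp at this ⊢
      linarith
    have e2 : ‖2 * (k : ℂ) + ν + 1‖ ≤ ((2 * k + M + 1 : ℕ) : ℝ) := by
      refine (norm_add_le _ _).trans ?_
      have := norm_add_le (2 * k : ℂ) ν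
      simp at this ⊢
      linarith
    have b1 := norm_risingChoose_le e1 k
    have b2 := norm_risingChoose_le e2 j
    simp only [hF, norm_mul, norm_pow, norm_neg, norm_one, one_pow, mul_one, hw]
    calc _ ≤ (2 : ℝ) ^ (k + M + k) * 2 ^ (2 * k + M + j) * w ^ (k + j) := by gcongr
      _ = _ := by
        rw [show (16 : ℝ) = 2 ^ 4 by norm_num, show (4 : ℝ) = 2 ^ 2 by norm_num, mul_pow, mul_pow]
        simp only [← pow_mul]
        ring
  have hsum : Summable F := by
    refine Summable.of_norm_bounded ?_ hbound
    refine Summable.mul_left _ ?_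
    have s1 : Summable fun k : ℕ => (16 * w) ^ k :=
      summable_geometric_of_lt_one (by positivity) (by linarith)
    have s2 : Summable fun k : ℕ => (2 * w) ^ k :=
      summable_geometric_of_lt_one (by positivity) (by linarith)
    exact s1.mul_of_nonneg s2 (fun _ => by positivity) (fun _ => by positivity)
  have hdiag : HasSum F (1 / (1 - (w : ℂ))) := by
    have hs := (Finset.HasAntidiagonal.sigmaAntidiagonalEquivProd (A := ℕ)).hasSum_iff.mpr
      hsum.hasSum
    have hs2 := hs.sigma (g := fun n => (w : ℂ) ^ n) (fun n => ?_)
    · have hg := hasSum_geometric_of_norm_lt_one (ξ := (w : ℂ)) (by rw [hw]; linarith)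
      rw [one_div, ← hs2.unique hg]
      exact hsum.hasSum
    · have := Finset.hasSum (Finset.HasAntidiagonal.antidiagonal n) F
      rw [← Finset.sum_coe_sort] at this
      convert hasSum_fintype _ using 1
      rw [← one_mul ((w : ℂ) ^ n), ← sum_antidiagonal_risingChoose ν n, Finset.sum_mul,
        ← Finset.sum_coe_sort]
      refine Finset.sum_congr rfl fun p _ => ?_
      have hp := Finset.HasAntidiagonal.mem_antidiagonal.mp p.2
      simp [hF, ← hp]
  refine hdiag.prod_fiberwise fun k => ?_
  have hx : ‖(-w : ℂ)‖ < 1 := by rw [norm_neg, hw]; linarith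
  have := ((hasSum_risingChoose (2 * k + ν + 1) hx).mul_left
    (risingChoose (k + ν + 1) k * (w : ℂ) ^ k))
  rw [sub_neg_eq_add, mul_assoc] at this
  refine this.congr_fun fun j => ?_
  simp only [hF]
  rw [neg_pow (w : ℂ), pow_add]
  ring

theorem norm_risingChoose_add_le (ν : ℂ) : ∃ M : ℕ, ∀ k : ℕ,
    ‖risingChoose (k + ν + 1) k‖ ≤ 2 ^ M * 4 ^ k := by
  obtain ⟨M, hM⟩ := exists_nat_ge ‖ν‖
  refine ⟨M, fun k => ?_⟩
  have e1 : ‖(k : ℂ) + ν + 1‖ ≤ ((k + M + 1 : ℕ) : ℝ) := by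
    refine (norm_add_le _ _).trans ?_
    have := norm_add_le (k : ℂ) ν
    simp at this ⊢
    linarith
  refine (norm_risingChoose_le e1 k).trans (le_of_eq ?_)
  rw [show (4 : ℝ) = 2 ^ 2 by norm_num, ← pow_mul, ← pow_add]
  congr 1
  ring

theorem analyticOnNhd_tsum_risingChoose (ν : ℂ) :
    AnalyticOnNhd ℂ (fun x : ℂ => ∑' k : ℕ, risingChoose (k + ν + 1) k * x ^ k)
      (Metric.ball 0 (1 / 4)) := by
  obtain ⟨M, hM⟩ := norm_risingChoose_add_le ν
  intro x hx
  rw [mem_ball_zero_iff] at hx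
  obtain ⟨r, hxr, hr⟩ := exists_between hx
  have hr0 : 0 ≤ r := (norm_nonneg x).trans hxr.le
  have hd : DifferentiableOn ℂ (fun x : ℂ => ∑' k : ℕ, risingChoose (k + ν + 1) k * x ^ k)
      (Metric.ball 0 r) := by
    refine Complex.differentiableOn_tsum_of_summable_norm
      (u := fun k => 2 ^ M * (4 * r) ^ k) ?_ ?_ Metric.isOpen_ball ?_
    · exact (summable_geometric_of_lt_one (by positivity) (by linarith)).mul_left _
    · intro k; fun_prop
    · intro k y hy
      rw [mem_ball_zero_iff] at hy
      rw [norm_mul, norm_pow, mul_pow, ← mul_assoc]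
      have := hM k
      gcongr
  exact hd.analyticAt (Metric.isOpen_ball.mem_nhds (by simpa using hxr))

/-- Each term is a power of `x = w / (1 + w)²`, which maps `(0, 1)` into the disc of convergence
`|x| < 1 / 4`. -/
theorem risingChoose_mul_cpow (ν : ℂ) {w : ℝ} (h0 : 0 < w) (k : ℕ) :
    risingChoose (k + ν + 1) k * ((w : ℂ) ^ k * (1 + (w : ℂ)) ^ (-(2 * k + ν + 1))) =
      (1 + (w : ℂ)) ^ (-(ν + 1)) *
        (risingChoose (k + ν + 1) k * ((w / (1 + w) ^ 2 : ℝ) : ℂ) ^ k) := by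
  have hne : (1 + (w : ℂ)) ≠ 0 := by
    have : (1 + w : ℝ) ≠ 0 := by positivity
    exact_mod_cast this
  rw [show -(2 * (k : ℂ) + ν + 1) = -(ν + 1) - ((2 * k : ℕ) : ℂ) by push_cast; ring,
    Complex.cpow_sub _ _ hne, Complex.cpow_natCast]
  push_cast
  rw [div_pow, ← pow_mul]
  ring

theorem div_one_add_sq_lt {w : ℝ} (h0 : 0 < w) (h1 : w < 1) : w / (1 + w) ^ 2 < 1 / 4 := by
  rw [div_lt_iff₀ (by positivity)]
  nlinarith [sq_pos_of_pos (sub_pos.mpr h1)]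

/-- The generating function of the generalised binomial coefficients `binom(2k + ν, k)`, in the
uniformising variable `w`. Small `w` is the rearrangement of a double series; both sides are real
analytic on `(0, 1)`. -/
theorem hasSum_risingChoose_generating (ν : ℂ) {w : ℝ} (h0 : 0 < w) (h1 : w < 1) :
    HasSum (fun k : ℕ => risingChoose (k + ν + 1) k *
      ((w : ℂ) ^ k * (1 + (w : ℂ)) ^ (-(2 * k + ν + 1)))) (1 / (1 - (w : ℂ))) := by
  obtain ⟨M, hM⟩ := norm_risingChoose_add_le ν
  set P : ℂ → ℂ := fun x : ℂ => ∑' k : ℕ, risingChoose (k + ν + 1) k * x ^ k with hP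
  set f : ℝ → ℂ := fun w => (1 + (w : ℂ)) ^ (-(ν + 1)) * P ((w / (1 + w) ^ 2 : ℝ) : ℂ) with hf
  have hsumm : ∀ w : ℝ, 0 < w → w < 1 → HasSum (fun k : ℕ => risingChoose (k + ν + 1) k *
      ((w : ℂ) ^ k * (1 + (w : ℂ)) ^ (-(2 * k + ν + 1)))) (f w) := by
    intro w h0 h1
    simp_rw [risingChoose_mul_cpow ν h0, hf]
    refine HasSum.mul_left _ (Summable.hasSum ?_)
    have hlt := div_one_add_sq_lt h0 h1
    refine Summable.of_norm_bounded (g := fun k => 2 ^ M * (4 * (w / (1 + w) ^ 2)) ^ k)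
      ((summable_geometric_of_lt_one (by positivity) (by linarith)).mul_left _) fun k => ?_
    rw [norm_mul, norm_pow, mul_pow, ← mul_assoc, Complex.norm_real, Real.norm_of_nonneg
      (by positivity)]
    have := hM k
    gcongr
  have hana : AnalyticOnNhd ℝ f (Ioo 0 1) := by
    rintro w ⟨h0, h1⟩
    have hof : ∀ g : ℝ → ℝ, AnalyticAt ℝ g w → AnalyticAt ℝ (fun w => ((g w : ℝ) : ℂ)) w :=
      fun g hg => (Complex.ofRealCLM.analyticAt _).comp hg
    have a1 : AnalyticAt ℝ (fun w : ℝ => (1 + (w : ℂ)) ^ (-(ν + 1))) w := by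
      have : AnalyticAt ℂ (fun z : ℂ => (1 + z) ^ (-(ν + 1))) (w : ℂ) := by
        refine AnalyticAt.cpow (by fun_prop) (by fun_prop) ?_
        left
        simp
        linarith
      exact (this.restrictScalars (𝕜 := ℝ)).comp (hof id analyticAt_id)
    have a2 : AnalyticAt ℝ (fun w : ℝ => P ((w / (1 + w) ^ 2 : ℝ) : ℂ)) w := by
      have hg : AnalyticAt ℝ (fun w : ℝ => w / (1 + w) ^ 2) w :=
        AnalyticAt.div (by fun_prop) (by fun_prop) (by positivity)
      have := analyticOnNhd_tsum_risingChoose ν ((w / (1 + w) ^ 2 : ℝ) : ℂ) (by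
        rw [mem_ball_zero_iff, Complex.norm_real, Real.norm_of_nonneg (by positivity)]
        exact div_one_add_sq_lt h0 h1)
      exact (this.restrictScalars (𝕜 := ℝ)).comp_of_eq (hof _ hg) rfl
    exact a1.mul a2
  have hana2 : AnalyticOnNhd ℝ (fun w : ℝ => 1 / (1 - (w : ℂ))) (Ioo 0 1) := by
    rintro w ⟨h0, h1⟩
    have hid : AnalyticAt ℝ (fun w : ℝ => (w : ℂ)) w := Complex.ofRealCLM.analyticAt _
    refine AnalyticAt.div analyticAt_const (analyticAt_const.sub hid) ?_
    have : (1 - w : ℝ) ≠ 0 := by linarith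
    exact_mod_cast this
  have heq := hana.eqOn_of_preconnected_of_eventuallyEq hana2 isPreconnected_Ioo
    (z₀ := 1 / 32) (by constructor <;> norm_num) (by
      filter_upwards [Ioo_mem_nhds (show (0 : ℝ) < 1 / 32 by norm_num)
        (show (1 / 32 : ℝ) < 1 / 16 by norm_num)] with w hw
      exact (hsumm w hw.1 (by linarith [hw.2])).unique (hasSum_risingChoose_of_small ν hw.1 hw.2))
  have := hsumm w h0 h1
  rwa [heq ⟨h0, h1⟩] at this

/-! ### Poisson's integral for `I_{iτ}` -/

theorem integrableOn_beta {a b : ℝ} (ha : 0 < a) (hb : 0 < b) :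
    IntegrableOn (fun x : ℝ => x ^ (a - 1) * (1 - x) ^ (b - 1)) (Ioo 0 1) := by
  have h := Complex.betaIntegral_convergent (u := a) (v := b) (by simpa) (by simpa)
  rw [intervalIntegrable_iff_integrableOn_Ioo_of_le zero_le_one] at h
  refine h.re.congr ?_
  filter_upwards [ae_restrict_mem measurableSet_Ioo] with x hx
  have h1 : (x : ℂ) ^ ((a : ℂ) - 1) = ((x ^ (a - 1) : ℝ) : ℂ) := by
    rw [Complex.ofReal_cpow hx.1.le]; simp
  have h2 : (1 - (x : ℂ)) ^ ((b : ℂ) - 1) = (((1 - x) ^ (b - 1) : ℝ) : ℂ) := by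
    rw [Complex.ofReal_cpow (by linarith [hx.2])]; simp
  rw [h1, h2, ← Complex.ofReal_mul]
  simp

/-- The arcsine weight `x^(-1/2) (1 - x)^(-1/2)`. -/
noncomputable def arcsineWeight (x : ℝ) : ℝ := x ^ (-(1 / 2) : ℝ) * (1 - x) ^ (-(1 / 2) : ℝ)

theorem arcsineWeight_nonneg {x : ℝ} (hx : x ∈ Ioo (0 : ℝ) 1) : 0 ≤ arcsineWeight x :=
  mul_nonneg (Real.rpow_nonneg hx.1.le _) (Real.rpow_nonneg (by linarith [hx.2]) _)

theorem integrableOn_arcsineWeight : IntegrableOn arcsineWeight (Ioo 0 1) := by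
  have := integrableOn_beta (a := 1 / 2) (b := 1 / 2) (by norm_num) (by norm_num)
  norm_num at this
  exact this.congr_fun (fun x _ => by simp [arcsineWeight]) measurableSet_Ioo

/-- The complex weight `x^(-1/2) (1 - x)^(iτ - 1/2)` of the Poisson representation. -/
noncomputable def poissonWeight (τ x : ℝ) : ℂ :=
  (x : ℂ) ^ (-(1 / 2) : ℂ) * (1 - (x : ℂ)) ^ (Complex.I * τ - 1 / 2)

theorem norm_poissonWeight (τ : ℝ) {x : ℝ} (hx : x ∈ Ioo (0 : ℝ) 1) :
    ‖poissonWeight τ x‖ = arcsineWeight x := by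
  have h : (1 - (x : ℂ)) = ((1 - x : ℝ) : ℂ) := by simp
  rw [poissonWeight, arcsineWeight, norm_mul, h, Complex.norm_cpow_eq_rpow_re_of_pos hx.1,
    Complex.norm_cpow_eq_rpow_re_of_pos (by linarith [hx.2])]
  norm_num

theorem measurable_poissonWeight (τ : ℝ) : Measurable (poissonWeight τ) := by
  unfold poissonWeight; fun_prop

/-- The moments of the Poisson weight are beta integrals. -/
theorem integral_pow_mul_poissonWeight (τ : ℝ) (k : ℕ) :
    ∫ x in Ioo (0 : ℝ) 1, (x : ℂ) ^ k * poissonWeight τ x =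
      Complex.Gamma (k + 1 / 2) * Complex.Gamma (1 / 2 + Complex.I * τ) /
        Complex.Gamma (k + Complex.I * τ + 1) := by
  have h := Complex.Gamma_mul_Gamma_eq_betaIntegral (s := k + 1 / 2)
    (t := 1 / 2 + Complex.I * τ) (by simp; positivity) (by simp)
  have hne : Complex.Gamma (k + Complex.I * τ + 1) ≠ 0 :=
    Complex.Gamma_ne_zero_of_re_pos (by simp; positivity)
  rw [eq_div_iff hne, h, mul_comm]
  congr 1
  · congr 1; ring
  · rw [Complex.betaIntegral, intervalIntegral.integral_of_le zero_le_one,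
      integral_Ioc_eq_integral_Ioo]
    refine setIntegral_congr_fun measurableSet_Ioo fun x hx => ?_
    have hx0 : (x : ℂ) ≠ 0 := by exact_mod_cast hx.1.ne'
    simp only [poissonWeight]
    rw [← mul_assoc, ← Complex.cpow_natCast, ← Complex.cpow_add _ _ hx0]
    congr 2 <;> ring

theorem integral_arcsineWeight : ∫ x in Ioo (0 : ℝ) 1, arcsineWeight x = Real.pi := by
  have h := integral_pow_mul_poissonWeight 0 0
  have h2 : ∫ x in Ioo (0 : ℝ) 1, (x : ℂ) ^ 0 * poissonWeight 0 x =
      ∫ x in Ioo (0 : ℝ) 1, (arcsineWeight x : ℂ) := by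
    refine setIntegral_congr_fun measurableSet_Ioo fun x hx => ?_
    have h3 : (1 - (x : ℂ)) = ((1 - x : ℝ) : ℂ) := by simp
    simp only [poissonWeight, arcsineWeight]
    rw [Complex.ofReal_mul, Complex.ofReal_cpow hx.1.le,
      Complex.ofReal_cpow (by linarith [hx.2])]
    simp
  rw [h2, integral_complex_ofReal] at h
  simp at h
  rw [← one_div, Complex.Gamma_one_half_eq,
    ← Complex.cpow_add _ _ (by exact_mod_cast Real.pi_ne_zero)] at h
  norm_num at h
  exact_mod_cast h

theorem hasSum_cosh_mul_sqrt (t : ℝ) {x : ℝ} (hx : 0 ≤ x) :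
    HasSum (fun k : ℕ => t ^ (2 * k) / ((2 * k).factorial : ℝ) * x ^ k)
      (Real.cosh (t * √x)) := by
  refine (Real.hasSum_cosh (t * √x)).congr_fun fun k => ?_
  rw [mul_pow, pow_mul (√x), Real.sq_sqrt hx]
  ring

/-- Legendre duplication at half-integers. -/
theorem gamma_nat_add_half (k : ℕ) :
    Complex.Gamma (k + 1 / 2) * ((4 : ℂ) ^ k * k.factorial) =
      ((2 * k).factorial : ℂ) * (√Real.pi : ℝ) := by
  have h := Complex.Gamma_mul_Gamma_add_half (k + 1 / 2)
  have e1 : (k : ℂ) + 1 / 2 + 1 / 2 = k + 1 := by ring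
  have e2 : 2 * ((k : ℂ) + 1 / 2) = ((2 * k : ℕ) : ℂ) + 1 := by push_cast; ring
  rw [e1, e2, Complex.Gamma_nat_eq_factorial, Complex.Gamma_nat_eq_factorial] at h
  rw [mul_left_comm, h, show (1 : ℂ) - (((2 * k : ℕ) : ℂ) + 1) = -((2 * k : ℕ) : ℂ) by ring,
    Complex.cpow_neg, Complex.cpow_natCast, pow_mul]
  norm_num
  field_simp

/-- The Poisson integral `∫₀¹ cosh (t √x) x^(-1/2) (1 - x)^(iτ - 1/2) dx`. -/
noncomputable def poissonIntegral (τ t : ℝ) : ℂ :=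
  ∫ x in Ioo (0 : ℝ) 1, (Real.cosh (t * √x) : ℂ) * poissonWeight τ x

/-- The Poisson integral at `τ = 0` divided by `π`, which is `I₀(t)`; it dominates `I_{iτ}(t)` up
to the factor `√cosh (πτ)`. -/
noncomputable def besselMajorant (t : ℝ) : ℝ :=
  Real.pi⁻¹ * ∫ x in Ioo (0 : ℝ) 1, Real.cosh (t * √x) * arcsineWeight x

theorem hasSum_poissonIntegral (τ t : ℝ) :
    HasSum (fun k : ℕ => ((t ^ (2 * k) / ((2 * k).factorial : ℝ) : ℝ) : ℂ) *
      ∫ x in Ioo (0 : ℝ) 1, (x : ℂ) ^ k * poissonWeight τ x) (poissonIntegral τ t) := by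
  have h := hasSum_integral_of_dominated_convergence (μ := volume.restrict (Ioo (0 : ℝ) 1))
    (F := fun (k : ℕ) (x : ℝ) => ((t ^ (2 * k) / ((2 * k).factorial : ℝ) : ℝ) : ℂ) *
      ((x : ℂ) ^ k * poissonWeight τ x))
    (f := fun x => (Real.cosh (t * √x) : ℂ) * poissonWeight τ x)
    (fun k x => t ^ (2 * k) / ((2 * k).factorial : ℝ) * arcsineWeight x) ?_ ?_ ?_ ?_ ?_
  · simpa only [integral_const_mul, poissonIntegral] using h
  · intro k
    have := measurable_poissonWeight τ
    exact (by fun_prop : Measurable _).aestronglyMeasurable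
  · intro k
    filter_upwards [ae_restrict_mem measurableSet_Ioo] with x hx
    have h1 : (0 : ℝ) ≤ t ^ (2 * k) := by rw [pow_mul]; positivity
    rw [norm_mul, norm_mul, norm_poissonWeight τ hx, norm_pow, Complex.norm_real,
      Complex.norm_real, Real.norm_of_nonneg hx.1.le, Real.norm_of_nonneg (by positivity)]
    have := arcsineWeight_nonneg hx
    have h2 : x ^ k ≤ 1 := pow_le_one₀ hx.1.le hx.2.le
    gcongr
    exact mul_le_of_le_one_left this h2
  · filter_upwards with x
    exact (Real.hasSum_cosh t).summable.mul_right _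
  · simp_rw [tsum_mul_right, (Real.hasSum_cosh t).tsum_eq]
    exact integrableOn_arcsineWeight.const_mul _
  · filter_upwards [ae_restrict_mem measurableSet_Ioo] with x hx
    have := (Complex.hasSum_ofReal.mpr (hasSum_cosh_mul_sqrt t hx.1.le)).mul_right
      (poissonWeight τ x)
    refine this.congr_fun fun k => ?_
    push_cast
    ring

/-- **Poisson's integral** for `I_{iτ}`. -/
theorem hasSum_besselI (τ : ℝ) {t : ℝ} (ht : 0 < t) :
    HasSum (fun k : ℕ => ((t : ℂ) / 2) ^ (2 * (k : ℂ) + Complex.I * τ) /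
      ((Nat.factorial k : ℂ) * Complex.Gamma ((k : ℂ) + Complex.I * τ + 1)))
      (((t : ℂ) / 2) ^ (Complex.I * τ) /
        ((√Real.pi : ℝ) * Complex.Gamma (1 / 2 + Complex.I * τ)) * poissonIntegral τ t) := by
  refine ((hasSum_poissonIntegral τ t).mul_left _).congr_fun fun k => ?_
  have ht2 : (t : ℂ) / 2 ≠ 0 := by
    have : t / 2 ≠ 0 := by positivity
    exact_mod_cast this
  have hpi : ((√Real.pi : ℝ) : ℂ) ≠ 0 := by
    have : √Real.pi ≠ 0 := by positivity
    exact_mod_cast this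
  have g1 : Complex.Gamma (1 / 2 + Complex.I * τ) ≠ 0 :=
    Complex.Gamma_ne_zero_of_re_pos (by simp)
  have g2 : Complex.Gamma (k + Complex.I * τ + 1) ≠ 0 :=
    Complex.Gamma_ne_zero_of_re_pos (by simp; positivity)
  have k1 : (k.factorial : ℂ) ≠ 0 := by exact_mod_cast k.factorial_ne_zero
  have k2 : ((2 * k).factorial : ℂ) ≠ 0 := by exact_mod_cast (2 * k).factorial_ne_zero
  rw [integral_pow_mul_poissonWeight, Complex.cpow_add _ _ ht2,
    show 2 * (k : ℂ) = ((2 * k : ℕ) : ℂ) by push_cast; rfl, Complex.cpow_natCast]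
  have hg := gamma_nat_add_half k
  rw [← eq_div_iff (mul_ne_zero (pow_ne_zero _ (by norm_num)) k1)] at hg
  rw [hg, div_pow, pow_mul 2]
  generalize Complex.Gamma (1 / 2 + Complex.I * τ) = G at g1 ⊢
  push_cast
  field_simp
  norm_num
  ring

theorem besselI_eq_poissonIntegral (τ : ℝ) {t : ℝ} (ht : 0 < t) :
    besselI (Complex.I * τ) t = ((t : ℂ) / 2) ^ (Complex.I * τ) /
        ((√Real.pi : ℝ) * Complex.Gamma (1 / 2 + Complex.I * τ)) * poissonIntegral τ t :=
  (hasSum_besselI τ ht).tsum_eq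

/-- The reflection formula on the line `Re s = 1/2`, where `1 - s` is the conjugate of `s`. -/
theorem norm_Gamma_half_add_sq (τ : ℝ) :
    ‖Complex.Gamma (1 / 2 + Complex.I * τ)‖ ^ 2 = Real.pi / Real.cosh (Real.pi * τ) := by
  have h := Complex.Gamma_mul_Gamma_one_sub (1 / 2 + Complex.I * τ)
  have e : (1 : ℂ) - (1 / 2 + Complex.I * τ) =
      (starRingEnd ℂ) (1 / 2 + Complex.I * τ) := by
    apply Complex.ext
    · simp; norm_num
    · simp
  rw [e, Complex.Gamma_conj, Complex.mul_conj, Complex.normSq_eq_norm_sq] at h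
  have hs : Complex.sin (Real.pi * (1 / 2 + Complex.I * τ)) = (Real.cosh (Real.pi * τ) : ℂ) := by
    rw [show (Real.pi : ℂ) * (1 / 2 + Complex.I * τ) = (Real.pi * τ : ℂ) * Complex.I + Real.pi / 2
      by ring, Complex.sin_add_pi_div_two, Complex.cos_mul_I]
    simp
  rw [hs] at h
  exact_mod_cast h

theorem norm_poissonIntegral_le (τ t : ℝ) :
    ‖poissonIntegral τ t‖ ≤ Real.pi * besselMajorant t := by
  rw [besselMajorant, mul_inv_cancel_left₀ Real.pi_ne_zero]
  refine (norm_integral_le_integral_norm _).trans (le_of_eq ?_)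
  refine setIntegral_congr_fun measurableSet_Ioo fun x hx => ?_
  rw [norm_mul, norm_poissonWeight τ hx, Complex.norm_real, Real.norm_of_nonneg
    (Real.cosh_pos _).le]

/-- Domination of `I_{iτ}` by `I₀`: pass to absolute values in Poisson's integral. -/
theorem norm_besselI_le (τ : ℝ) {t : ℝ} (ht : 0 < t) :
    ‖besselI (Complex.I * τ) t‖ ≤ √(Real.cosh (Real.pi * τ)) * besselMajorant t := by
  have hc : (0 : ℝ) < Real.cosh (Real.pi * τ) := Real.cosh_pos _
  have hG : ‖Complex.Gamma (1 / 2 + Complex.I * τ)‖ = √Real.pi / √(Real.cosh (Real.pi * τ)) := by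
    rw [← Real.sqrt_div Real.pi_pos.le, ← norm_Gamma_half_add_sq, Real.sqrt_sq (norm_nonneg _)]
  have hp : ‖((t : ℂ) / 2) ^ (Complex.I * τ)‖ = 1 := by
    rw [show (t : ℂ) / 2 = ((t / 2 : ℝ) : ℂ) by push_cast; rfl,
      Complex.norm_cpow_eq_rpow_re_of_pos (by positivity)]
    simp
  rw [besselI_eq_poissonIntegral τ ht, norm_mul, norm_div, hp, norm_mul, hG, Complex.norm_real,
    Real.norm_of_nonneg (by positivity)]
  have hpi : √Real.pi * √Real.pi = Real.pi := Real.mul_self_sqrt Real.pi_pos.le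
  rw [← mul_div_assoc, hpi, one_div_div, div_mul_eq_mul_div, div_le_iff₀ Real.pi_pos, mul_assoc]
  have := norm_poissonIntegral_le τ t
  rw [mul_comm Real.pi] at this
  gcongr

theorem continuous_poissonIntegral (τ : ℝ) : Continuous (poissonIntegral τ) := by
  rw [continuous_iff_continuousAt]
  intro t₀
  refine continuousAt_of_dominated (bound := fun x => Real.cosh (|t₀| + 1) * arcsineWeight x)
    ?_ ?_ (integrableOn_arcsineWeight.const_mul _) ?_
  · refine Eventually.of_forall fun t => ?_
    have := measurable_poissonWeight τ
    exact (by fun_prop : Measurable _).aestronglyMeasurable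
  · filter_upwards [Metric.ball_mem_nhds t₀ one_pos] with t ht
    filter_upwards [ae_restrict_mem measurableSet_Ioo] with x hx
    rw [norm_mul, norm_poissonWeight τ hx, Complex.norm_real, Real.norm_of_nonneg
      (Real.cosh_pos _).le]
    have := arcsineWeight_nonneg hx
    gcongr 1
    rw [Real.cosh_le_cosh, abs_mul, abs_of_nonneg (Real.sqrt_nonneg x),
      abs_of_nonneg (by positivity : 0 ≤ |t₀| + 1)]
    have h1 : √x ≤ 1 := Real.sqrt_le_one.mpr hx.2.le
    have h2 : |t| ≤ |t₀| + 1 := by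
      have := abs_sub_abs_le_abs_sub t t₀
      rw [Metric.mem_ball, Real.dist_eq] at ht
      linarith
    exact (mul_le_of_le_one_right (abs_nonneg t) h1).trans h2
  · filter_upwards with x
    fun_prop

theorem continuousOn_besselI (τ : ℝ) :
    ContinuousOn (fun t : ℝ => besselI (Complex.I * τ) t) (Ioi 0) := by
  have : ContinuousOn (fun t : ℝ => ((t : ℂ) / 2) ^ (Complex.I * τ) /
        ((√Real.pi : ℝ) * Complex.Gamma (1 / 2 + Complex.I * τ)) * poissonIntegral τ t)
        (Ioi 0) := by
    refine ContinuousOn.mul (ContinuousOn.div_const ?_ _)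
      (continuous_poissonIntegral τ).continuousOn
    refine ContinuousOn.cpow_const (by fun_prop) fun t ht => ?_
    left
    simpa using ht
  exact this.congr fun t ht => besselI_eq_poissonIntegral τ ht

/-! ### Bounds, measurability and the Laplace transform of `I_{iτ}` -/

theorem cosh_le_exp {y : ℝ} (hy : 0 ≤ y) : Real.cosh y ≤ Real.exp y := by
  rw [Real.cosh_eq]
  linarith [Real.exp_le_exp.mpr (show -y ≤ y by linarith)]

theorem besselMajorant_le_exp {t : ℝ} (ht : 0 < t) : besselMajorant t ≤ Real.exp t := by
  have h : ∫ x in Ioo (0 : ℝ) 1, Real.cosh (t * √x) * arcsineWeight x ≤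
      ∫ x in Ioo (0 : ℝ) 1, Real.exp t * arcsineWeight x := by
    refine integral_mono_of_nonneg ?_ (integrableOn_arcsineWeight.const_mul _) ?_
    · filter_upwards [ae_restrict_mem measurableSet_Ioo] with x hx
      exact mul_nonneg (Real.cosh_pos _).le (arcsineWeight_nonneg hx)
    · filter_upwards [ae_restrict_mem measurableSet_Ioo] with x hx
      refine mul_le_mul_of_nonneg_right ?_ (arcsineWeight_nonneg hx)
      refine (cosh_le_exp (by positivity)).trans (Real.exp_le_exp.mpr ?_)
      exact mul_le_of_le_one_right ht.le (Real.sqrt_le_one.mpr hx.2.le)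
  rw [integral_const_mul, integral_arcsineWeight] at h
  rw [besselMajorant, inv_mul_le_iff₀ Real.pi_pos, mul_comm Real.pi]
  exact h

theorem exp_neg_le_rpow {y : ℝ} (hy : 0 < y) : Real.exp (-y) ≤ y ^ (-(1 / 4) : ℝ) := by
  rw [Real.exp_neg, Real.rpow_neg hy.le]
  refine inv_anti₀ (Real.rpow_pos_of_pos hy _) ?_
  have h : y ^ (1 / 4 : ℝ) ≤ y + 1 := by
    rcases le_total y 1 with h | h
    · exact (Real.rpow_le_one hy.le h (by norm_num)).trans (by linarith)
    · exact (Real.rpow_le_self_of_one_le h (by norm_num)).trans (by linarith)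
  exact h.trans (Real.add_one_le_exp y)

/-- A crude form of the decay `e⁻ᵗ I₀(t) = O(t^(-1/2))`. It follows from
`e^(-t(1 - √x)) ≤ (t (1 - x) / 2)^(-1/4)` under the Poisson integral. -/
theorem exists_besselMajorant_le :
    ∃ C : ℝ, 0 ≤ C ∧ ∀ t : ℝ, 0 < t →
      besselMajorant t ≤ C * (t ^ (-(1 / 4) : ℝ) * Real.exp t) := by
  have hint := integrableOn_beta (a := 1 / 2) (b := 1 / 4) (by norm_num) (by norm_num)
  set B := ∫ x in Ioo (0 : ℝ) 1, x ^ ((1 / 2 : ℝ) - 1) * (1 - x) ^ ((1 / 4 : ℝ) - 1) with hB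
  have hB0 : 0 ≤ B := by
    refine setIntegral_nonneg measurableSet_Ioo fun x hx => ?_
    exact mul_nonneg (Real.rpow_nonneg hx.1.le _) (Real.rpow_nonneg (by linarith [hx.2]) _)
  refine ⟨Real.pi⁻¹ * (2 ^ (1 / 4 : ℝ) * B), by positivity, fun t ht => ?_⟩
  have h : ∫ x in Ioo (0 : ℝ) 1, Real.cosh (t * √x) * arcsineWeight x ≤
      ∫ x in Ioo (0 : ℝ) 1, (2 ^ (1 / 4 : ℝ) * (t ^ (-(1 / 4) : ℝ) * Real.exp t)) *
        (x ^ ((1 / 2 : ℝ) - 1) * (1 - x) ^ ((1 / 4 : ℝ) - 1)) := by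
    refine integral_mono_of_nonneg ?_ (hint.const_mul _) ?_
    · filter_upwards [ae_restrict_mem measurableSet_Ioo] with x hx
      exact mul_nonneg (Real.cosh_pos _).le (arcsineWeight_nonneg hx)
    · filter_upwards [ae_restrict_mem measurableSet_Ioo] with x hx
      have hx1 : 0 < 1 - x := by linarith [hx.2]
      have hs : √x ≤ 1 - (1 - x) / 2 := by
        nlinarith [Real.sq_sqrt hx.1.le, sq_nonneg (√x - 1)]
      have h1 : Real.cosh (t * √x) ≤ 2 ^ (1 / 4 : ℝ) * (t ^ (-(1 / 4) : ℝ) * Real.exp t) *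
          (1 - x) ^ (-(1 / 4) : ℝ) := by
        calc Real.cosh (t * √x) ≤ Real.exp (t * √x) := cosh_le_exp (by positivity)
          _ ≤ Real.exp (t + -(t * (1 - x) / 2)) := by
              refine Real.exp_le_exp.mpr ?_
              nlinarith
          _ = Real.exp t * Real.exp (-(t * (1 - x) / 2)) := Real.exp_add _ _
          _ ≤ Real.exp t * (t * (1 - x) / 2) ^ (-(1 / 4) : ℝ) := by
              gcongr
              exact exp_neg_le_rpow (by positivity)
          _ = _ := by
              rw [Real.div_rpow (by positivity) (by norm_num), Real.mul_rpow ht.le hx1.le,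
                Real.rpow_neg (show (0 : ℝ) ≤ 2 by norm_num), div_inv_eq_mul]
              ring
      calc Real.cosh (t * √x) * arcsineWeight x ≤ _ * arcsineWeight x :=
            mul_le_mul_of_nonneg_right h1 (arcsineWeight_nonneg hx)
        _ = _ := by
          rw [arcsineWeight, show (1 / 4 : ℝ) - 1 = -(1 / 4) + -(1 / 2) by norm_num,
            Real.rpow_add hx1, show (1 / 2 : ℝ) - 1 = -(1 / 2) by norm_num]
          ring
  rw [integral_const_mul] at h
  rw [besselMajorant]
  calc _ ≤ Real.pi⁻¹ * (2 ^ (1 / 4 : ℝ) * (t ^ (-(1 / 4) : ℝ) * Real.exp t) * B) := by gcongr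
    _ = _ := by ring

theorem norm_besselI_le_exp (τ : ℝ) {t : ℝ} (ht : 0 < t) :
    ‖besselI (Complex.I * τ) t‖ ≤ √(Real.cosh (Real.pi * τ)) * Real.exp t :=
  (norm_besselI_le τ ht).trans (by gcongr; exact besselMajorant_le_exp ht)

theorem exists_norm_besselI_le :
    ∃ C : ℝ, 0 ≤ C ∧ ∀ τ t : ℝ, 0 < t →
      ‖besselI (Complex.I * τ) t‖ ≤
        √(Real.cosh (Real.pi * τ)) * (C * (t ^ (-(1 / 4) : ℝ) * Real.exp t)) := by
  obtain ⟨C, hC, h⟩ := exists_besselMajorant_le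
  exact ⟨C, hC, fun τ t ht => (norm_besselI_le τ ht).trans (by gcongr; exact h t ht)⟩

theorem measurable_poissonIntegral :
    Measurable fun q : ℝ × ℝ => poissonIntegral q.1 q.2 := by
  unfold poissonIntegral
  have : StronglyMeasurable fun q : (ℝ × ℝ) × ℝ =>
      (Real.cosh (q.1.2 * √q.2) : ℂ) * poissonWeight q.1.1 q.2 := by
    unfold poissonWeight
    exact (by fun_prop : Measurable _).stronglyMeasurable
  exact this.integral_prod_right'.measurable

/-- Joint measurability in index and argument, on the half-plane of positive arguments. -/
theorem exists_measurable_eq_besselI :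
    ∃ B : ℝ × ℝ → ℂ, Measurable B ∧
      ∀ τ t : ℝ, 0 < t → B (τ, t) = besselI (Complex.I * τ) t := by
  refine ⟨fun q => ((q.2 : ℂ) / 2) ^ (Complex.I * q.1) /
        ((√Real.pi : ℝ) * Complex.Gamma (1 / 2 + Complex.I * q.1)) * poissonIntegral q.1 q.2,
    ?_, fun τ t ht => (besselI_eq_poissonIntegral τ ht).symm⟩
  have h1 : Measurable fun q : ℝ × ℝ => Complex.Gamma (1 / 2 + Complex.I * q.1) := by
    have : Continuous fun τ : ℝ => Complex.Gamma (1 / 2 + Complex.I * τ) := by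
      refine continuous_iff_continuousAt.mpr fun τ => ?_
      refine ContinuousAt.comp (f := fun τ : ℝ => (1 / 2 + Complex.I * τ : ℂ))
        (Complex.differentiableAt_Gamma _ fun m hm => ?_).continuousAt (by fun_prop)
      have := congrArg Complex.re hm
      simp at this
      linarith [(Nat.cast_nonneg m : (0 : ℝ) ≤ m)]
    exact this.measurable.comp measurable_fst
  have h2 := measurable_poissonIntegral
  fun_prop

theorem norm_Gamma_le_norm_Gamma_add (τ : ℝ) (k : ℕ) :
    k.factorial * ‖Complex.Gamma (Complex.I * τ + 1)‖ ≤
      ‖Complex.Gamma (k + Complex.I * τ + 1)‖ := by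
  induction k with
  | zero => simp
  | succ k ih =>
    have hne : (k : ℂ) + Complex.I * τ + 1 ≠ 0 := by
      intro h
      have := congrArg Complex.re h
      simp at this
      linarith [(Nat.cast_nonneg k : (0 : ℝ) ≤ k)]
    have e : ((k + 1 : ℕ) : ℂ) + Complex.I * τ + 1 = (k + Complex.I * τ + 1) + 1 := by
      push_cast; ring
    rw [e, Complex.Gamma_add_one _ hne, norm_mul, Nat.factorial_succ]
    have h1 : ((k + 1 : ℕ) : ℝ) ≤ ‖(k : ℂ) + Complex.I * τ + 1‖ := by
      refine le_trans (le_of_eq ?_) (Complex.re_le_norm _)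
      simp
    push_cast at h1 ⊢
    rw [mul_assoc]
    gcongr

theorem gamma_add_nat_eq {a : ℂ} (ha : 0 < a.re) (k : ℕ) :
    Complex.Gamma (a + k) = (ascPochhammer ℂ k).eval a * Complex.Gamma a := by
  induction k with
  | zero => simp
  | succ k ih =>
    have hne : a + k ≠ 0 := by
      intro h
      have := congrArg Complex.re h
      simp at this
      linarith [(Nat.cast_nonneg k : (0 : ℝ) ≤ k)]
    rw [ascPochhammer_succ_eval, Nat.cast_succ, ← add_assoc, Complex.Gamma_add_one _ hne, ih]
    ring

theorem factorial_two_mul_le (k : ℕ) : ((2 * k).factorial : ℝ) ≤ 4 ^ k * k.factorial ^ 2 := by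
  have h1 := Nat.choose_mul_factorial_mul_factorial (show k ≤ 2 * k by omega)
  have h2 := Nat.choose_le_two_pow (2 * k) k
  rw [show 2 * k - k = k by omega] at h1
  rw [pow_mul] at h2
  rw [← h1, mul_assoc, ← sq]
  exact_mod_cast Nat.mul_le_mul_right _ h2

theorem integral_exp_mul_besselI_term (τ : ℝ) {p : ℝ} (hp : 0 < p) (k : ℕ) :
    ∫ t in Ioi (0 : ℝ), (((t : ℂ) / 2) ^ (2 * (k : ℂ) + Complex.I * τ) /
      ((Nat.factorial k : ℂ) * Complex.Gamma ((k : ℂ) + Complex.I * τ + 1))) *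
        (Real.exp (-(p * t)) : ℂ) =
    2 * (risingChoose (k + Complex.I * τ + 1) k *
      (1 / (2 * p : ℂ)) ^ (2 * (k : ℂ) + Complex.I * τ + 1)) := by
  have ha : 0 < (2 * (k : ℂ) + Complex.I * τ + 1).re := by simp; positivity
  have h := Complex.integral_cpow_mul_exp_neg_mul_Ioi ha
    hp
  have g2 : Complex.Gamma (k + Complex.I * τ + 1) ≠ 0 :=
    Complex.Gamma_ne_zero_of_re_pos (by simp; positivity)
  have hG := gamma_add_nat_eq (a := k + Complex.I * τ + 1) (by simp; positivity) k
  rw [show (k : ℂ) + Complex.I * τ + 1 + k = 2 * k + Complex.I * τ + 1 by ring] at hG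
  rw [hG] at h
  have h2 : (2 : ℂ) ^ (2 * (k : ℂ) + Complex.I * τ) ≠ 0 := by simp [Complex.cpow_eq_zero_iff]
  have e : ∀ t ∈ Ioi (0 : ℝ), (((t : ℂ) / 2) ^ (2 * (k : ℂ) + Complex.I * τ) /
      ((Nat.factorial k : ℂ) * Complex.Gamma ((k : ℂ) + Complex.I * τ + 1))) *
        (Real.exp (-(p * t)) : ℂ) =
      ((2 : ℂ) ^ (2 * (k : ℂ) + Complex.I * τ) * ((Nat.factorial k : ℂ) *
        Complex.Gamma ((k : ℂ) + Complex.I * τ + 1)))⁻¹ *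
      ((t : ℂ) ^ (2 * (k : ℂ) + Complex.I * τ + 1 - 1) * Complex.exp (-(p * t))) := by
    intro t ht
    have ht0 : (0 : ℝ) ≤ t := le_of_lt ht
    rw [show (t : ℂ) / 2 = (t : ℂ) / ((2 : ℝ) : ℂ) by norm_num,
      Complex.div_cpow_ofReal_nonneg ht0 (by norm_num : (0 : ℝ) ≤ 2), add_sub_cancel_right]
    push_cast
    rw [mul_inv, div_div, div_mul_eq_mul_div, div_eq_mul_inv]
    rw [mul_inv]
    ring
  have h2p : (1 / (2 * p : ℂ)) ^ (2 * (k : ℂ) + Complex.I * τ + 1) =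
      (1 / (p : ℂ)) ^ (2 * (k : ℂ) + Complex.I * τ + 1) /
        ((2 : ℂ) ^ (2 * (k : ℂ) + Complex.I * τ) * 2) := by
    rw [show (1 : ℂ) / (2 * p) = ((1 / p : ℝ) : ℂ) / ((2 : ℝ) : ℂ) by push_cast; ring,
      Complex.div_cpow_ofReal_nonneg (by positivity) (by norm_num : (0 : ℝ) ≤ 2)]
    push_cast
    rw [Complex.cpow_add _ 1 (two_ne_zero), Complex.cpow_one]
  rw [setIntegral_congr_fun measurableSet_Ioi e, integral_const_mul, h, h2p, risingChoose]
  have k1 : (k.factorial : ℂ) ≠ 0 := by exact_mod_cast k.factorial_ne_zero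
  field_simp

/-- The terms of the series of `I_{iτ}` are dominated by those of `cosh`. -/
theorem norm_besselI_term_le (τ : ℝ) {t : ℝ} (ht : 0 < t) (k : ℕ) :
    ‖((t : ℂ) / 2) ^ (2 * (k : ℂ) + Complex.I * τ) /
      ((Nat.factorial k : ℂ) * Complex.Gamma ((k : ℂ) + Complex.I * τ + 1))‖ ≤
    t ^ (2 * k) / ((2 * k).factorial : ℝ) * ‖Complex.Gamma (Complex.I * τ + 1)‖⁻¹ := by
  have g1 : 0 < ‖Complex.Gamma (Complex.I * τ + 1)‖ :=
    norm_pos_iff.mpr (Complex.Gamma_ne_zero_of_re_pos (by simp))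
  have hk : (0 : ℝ) < k.factorial := by exact_mod_cast k.factorial_pos
  have hk2 : (0 : ℝ) < (2 * k).factorial := by exact_mod_cast (2 * k).factorial_pos
  have hn : ‖((t : ℂ) / 2) ^ (2 * (k : ℂ) + Complex.I * τ)‖ = (t / 2) ^ (2 * k) := by
    rw [show (t : ℂ) / 2 = ((t / 2 : ℝ) : ℂ) by push_cast; rfl,
      Complex.norm_cpow_eq_rpow_re_of_pos (by positivity)]
    rw [← Real.rpow_natCast]
    simp
  rw [norm_div, hn, norm_mul, Complex.norm_natCast, ← div_eq_mul_inv, div_div, div_pow, div_div]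
  refine div_le_div_of_nonneg_left (by positivity) (by positivity) ?_
  have h1 := factorial_two_mul_le k
  have h2 := norm_Gamma_le_norm_Gamma_add τ k
  calc _ ≤ (4 ^ k * (k.factorial : ℝ) ^ 2) * ‖Complex.Gamma (Complex.I * τ + 1)‖ := by gcongr
    _ = 2 ^ (2 * k) * (k.factorial *
        (k.factorial * ‖Complex.Gamma (Complex.I * τ + 1)‖)) := by
      rw [pow_mul]; norm_num; ring
    _ ≤ _ := by gcongr

theorem integrableOn_exp_mul_cosh {p : ℝ} (hp : 1 < p) :
    IntegrableOn (fun t : ℝ => Real.cosh t * Real.exp (-(p * t))) (Ioi 0) := by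
  have h1 := (integrableOn_exp_mul_Ioi (a := 1 - p) (by linarith) 0).add
    (integrableOn_exp_mul_Ioi (a := -1 - p) (by linarith) 0)
  refine IntegrableOn.congr_fun (h1.div_const 2) (fun t _ => ?_) measurableSet_Ioi
  simp only [Pi.add_apply]
  rw [Real.cosh_eq, div_mul_eq_mul_div, add_mul, ← Real.exp_add, ← Real.exp_add]
  ring_nf

/-- The Laplace transform of `I_{iτ}` at `cosh u`, found term by term. -/
theorem integral_besselI_mul_exp (τ : ℝ) {u : ℝ} (hu : 0 < u) :
    ∫ t in Ioi (0 : ℝ), besselI (Complex.I * τ) t * (Real.exp (-(Real.cosh u * t)) : ℂ) =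
      Complex.exp (-(Complex.I * τ * u)) / (Real.sinh u : ℂ) := by
  have hp : 1 < Real.cosh u := Real.one_lt_cosh.mpr hu.ne'
  set ν : ℂ := Complex.I * τ with hν
  have h := hasSum_integral_of_dominated_convergence (μ := volume.restrict (Ioi (0 : ℝ)))
    (F := fun (k : ℕ) (t : ℝ) => (((t : ℂ) / 2) ^ (2 * (k : ℂ) + ν) /
      ((Nat.factorial k : ℂ) * Complex.Gamma ((k : ℂ) + ν + 1))) *
        (Real.exp (-(Real.cosh u * t)) : ℂ))
    (f := fun t => besselI ν t * (Real.exp (-(Real.cosh u * t)) : ℂ))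
    (fun k t => t ^ (2 * k) / ((2 * k).factorial : ℝ) * ‖Complex.Gamma (ν + 1)‖⁻¹ *
      Real.exp (-(Real.cosh u * t))) ?_ ?_ ?_ ?_ ?_
  · simp_rw [hν, integral_exp_mul_besselI_term τ (Real.cosh_pos u), ← hν] at h
    refine h.unique ?_
    -- In the variable `w = e^(-2u)` one has `1 / (2 cosh u) = e⁻ᵘ / (1 + w)`.
    set w : ℝ := Real.exp (-(2 * u)) with hw
    have hw1 : w < 1 := by
      rw [hw, ← Real.exp_zero]
      exact Real.exp_lt_exp.mpr (by linarith)
    have hw0 : 0 < w := Real.exp_pos _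
    have hg := (hasSum_risingChoose_generating ν hw0 hw1).mul_left
      (2 * Complex.exp (-(u * (ν + 1))))
    have hval : Complex.exp (-(ν * u)) / (Real.sinh u : ℂ) =
        2 * Complex.exp (-(u * (ν + 1))) * (1 / (1 - (w : ℂ))) := by
      have hE : Complex.exp u * Complex.exp (-u) = 1 := by rw [← Complex.exp_add]; simp
      have hwe : (w : ℂ) = Complex.exp (-u) * Complex.exp (-u) := by
        rw [← Complex.exp_add, hw]; push_cast; ring_nf
      have hs : (Real.sinh u : ℂ) ≠ 0 := by
        exact_mod_cast (Real.sinh_pos_iff.mpr hu).ne'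
      have hw2 : (1 : ℂ) - w ≠ 0 := by
        have : (1 - w : ℝ) ≠ 0 := by linarith
        exact_mod_cast this
      have hsw : (Real.sinh u : ℂ) * 2 * Complex.exp (-u) = 1 - w := by
        rw [hwe, Complex.ofReal_sinh, Complex.sinh]
        linear_combination hE
      have hnu : Complex.exp (-(u * (ν + 1))) = Complex.exp (-(ν * u)) * Complex.exp (-u) := by
        rw [← Complex.exp_add]; ring_nf
      rw [hnu, mul_one_div, div_eq_div_iff hs hw2]
      linear_combination (-Complex.exp (-(ν * u))) * hsw
    rw [hval]
    refine hg.congr_fun fun k => ?_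
    · have hb : (1 : ℂ) / (2 * (Real.cosh u : ℂ)) =
          ((Real.exp (-u) : ℝ) : ℂ) * (((1 + w)⁻¹ : ℝ) : ℂ) := by
        have : (1 : ℝ) / (2 * Real.cosh u) = Real.exp (-u) * (1 + w)⁻¹ := by
          have hE : Real.exp u * Real.exp (-u) = 1 := by rw [← Real.exp_add]; simp
          have hwe : w = Real.exp (-u) * Real.exp (-u) := by
            rw [← Real.exp_add, hw]; ring_nf
          have h1w : (1 + w) ≠ 0 := by positivity
          have := Real.cosh_pos u
          rw [← div_eq_mul_inv, div_eq_div_iff (by positivity) h1w, hwe, Real.cosh_eq]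
          linear_combination -hE
        exact_mod_cast congrArg (fun x : ℝ => (x : ℂ)) this
      have hinv : (((1 + w)⁻¹ : ℝ) : ℂ) ^ (2 * (k : ℂ) + ν + 1) =
          (1 + (w : ℂ)) ^ (-(2 * (k : ℂ) + ν + 1)) := by
        rw [Complex.cpow_neg, Complex.ofReal_inv, Complex.inv_cpow]
        · push_cast; rfl
        · rw [Complex.arg_ofReal_of_nonneg (by positivity)]
          exact Real.pi_pos.ne
      have hexp : ((Real.exp (-u) : ℝ) : ℂ) ^ (2 * (k : ℂ) + ν + 1) =
          Complex.exp (-(u * (ν + 1))) * (w : ℂ) ^ k := by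
        rw [Complex.cpow_def_of_ne_zero (by simp), ← Complex.ofReal_log (Real.exp_pos _).le,
          Real.log_exp, hw, Complex.ofReal_exp, ← Complex.exp_nat_mul, ← Complex.exp_add]
        push_cast
        ring_nf
      rw [hb, Complex.mul_cpow_ofReal_nonneg (Real.exp_pos _).le (by positivity), hinv, hexp]
      ring
  · intro k
    exact (by fun_prop : Measurable _).aestronglyMeasurable
  · intro k
    filter_upwards [ae_restrict_mem measurableSet_Ioi] with t ht
    rw [norm_mul, Complex.norm_real, Real.norm_of_nonneg (Real.exp_pos _).le]
    exact mul_le_mul_of_nonneg_right (norm_besselI_term_le τ ht k) (Real.exp_pos _).le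
  · filter_upwards with t
    exact ((Real.hasSum_cosh t).summable.mul_right _).mul_right _
  · simp_rw [tsum_mul_right, (Real.hasSum_cosh _).tsum_eq]
    refine IntegrableOn.congr_fun ((integrableOn_exp_mul_cosh hp).mul_const
      ‖Complex.Gamma (ν + 1)‖⁻¹) (fun t _ => ?_) measurableSet_Ioi
    ring
  · filter_upwards [ae_restrict_mem measurableSet_Ioi] with t ht
    have := (hasSum_besselI τ ht)
    rw [← besselI_eq_poissonIntegral τ ht] at this
    exact this.mul_right _

/-! ### The Fourier transform of `1 / (cosh u + cosh v)` -/

theorem sigmoid_mul_one_sub_eq (v : ℝ) :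
    v.sigmoid * (1 - v.sigmoid) = 1 / (2 * (1 + Real.cosh v)) := by
  have h1 : 0 < Real.exp v := Real.exp_pos _
  have h2 : Real.exp (-v) = (Real.exp v)⁻¹ := Real.exp_neg v
  rw [Real.sigmoid_def, Real.cosh_eq, h2]
  field_simp
  ring

theorem sigmoid_add_sub_sigmoid_sub (u v : ℝ) :
    (v + u).sigmoid - (v - u).sigmoid = Real.sinh u / (Real.cosh u + Real.cosh v) := by
  have h1 : 0 < Real.exp v := Real.exp_pos _
  have h2 : 0 < Real.exp u := Real.exp_pos _
  rw [Real.sigmoid_def, Real.sigmoid_def, Real.cosh_eq, Real.cosh_eq, Real.sinh_eq,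
    show -(v + u) = -v + -u by ring, show -(v - u) = -v + u by ring, Real.exp_add, Real.exp_add,
    Real.exp_neg, Real.exp_neg]
  field_simp
  ring

theorem integrable_inv_one_add_cosh : Integrable fun v : ℝ => 1 / (2 * (1 + Real.cosh v)) := by
  have h := integrableOn_image_iff_integrableOn_abs_deriv_smul (F := ℝ) MeasurableSet.univ
    (fun v _ => (Real.hasDerivAt_sigmoid v).hasDerivWithinAt) Real.sigmoid_injective.injOn
    (fun _ => 1)
  rw [image_univ, Real.range_sigmoid, integrableOn_univ] at h
  refine (h.mp (by simp)).congr (Eventually.of_forall fun v => ?_)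
  simp only [smul_eq_mul, mul_one]
  rw [sigmoid_mul_one_sub_eq, abs_of_nonneg]
  have := Real.cosh_pos v
  positivity

/-- The Fourier transform of the logistic density, read off from the beta integral
`B(1 + iτ, 1 - iτ)` by the substitution `x = sigmoid v`. -/
theorem fourier_inv_one_add_cosh {τ : ℝ} (hτ : τ ≠ 0) :
    ∫ v : ℝ, Complex.exp (Complex.I * τ * v) * ((1 / (2 * (1 + Real.cosh v)) : ℝ) : ℂ) =
      ((Real.pi * τ / Real.sinh (Real.pi * τ) : ℝ) : ℂ) := by
  have hb := Complex.Gamma_mul_Gamma_eq_betaIntegral (s := 1 + Complex.I * τ)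
    (t := 1 - Complex.I * τ) (by simp) (by simp)
  have hi := integral_image_eq_integral_abs_deriv_smul (F := ℂ) MeasurableSet.univ
    (fun v _ => (Real.hasDerivAt_sigmoid v).hasDerivWithinAt) Real.sigmoid_injective.injOn
    (fun x => (x : ℂ) ^ (1 + Complex.I * τ - 1) * (1 - (x : ℂ)) ^ (1 - Complex.I * τ - 1))
  rw [image_univ, Real.range_sigmoid, setIntegral_univ, ← integral_Ioc_eq_integral_Ioo,
    ← intervalIntegral.integral_of_le zero_le_one, ← Complex.betaIntegral] at hi
  have hI : Complex.I * τ ≠ 0 := by simp [hτ]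
  have hs : Real.sinh (Real.pi * τ) ≠ 0 := by
    rw [Ne, Real.sinh_eq_zero]
    exact mul_ne_zero Real.pi_ne_zero hτ
  have hsin : Complex.sin (Real.pi * (Complex.I * τ)) =
      (Real.sinh (Real.pi * τ) : ℂ) * Complex.I := by
    rw [show (Real.pi : ℂ) * (Complex.I * τ) = (Real.pi * τ : ℂ) * Complex.I by ring,
      Complex.sin_mul_I]
    push_cast; rfl
  have hrefl := Complex.Gamma_mul_Gamma_one_sub (Complex.I * τ)
  have hb2 : Complex.betaIntegral (1 + Complex.I * τ) (1 - Complex.I * τ) =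
      ((Real.pi * τ / Real.sinh (Real.pi * τ) : ℝ) : ℂ) := by
    rw [show (1 : ℂ) + Complex.I * τ + (1 - Complex.I * τ) = 1 + 1 by ring,
      Complex.Gamma_add_one 1 one_ne_zero, Complex.Gamma_one, one_mul, one_mul] at hb
    rw [← hb, add_comm 1, Complex.Gamma_add_one _ hI, mul_assoc, hrefl, hsin]
    have : ((Real.sinh (Real.pi * τ) : ℝ) : ℂ) ≠ 0 := by exact_mod_cast hs
    push_cast at this ⊢
    field_simp
  rw [← hb2, hi]
  refine integral_congr_ae (Eventually.of_forall fun v => ?_)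
  have hc := Real.cosh_pos v
  have hσ := Real.sigmoid_pos v
  have h1 : (1 : ℝ) - v.sigmoid = v.sigmoid * Real.exp (-v) := by
    rw [Real.sigmoid_mul_rexp_neg, Real.sigmoid_neg]
  have h2 : (1 : ℂ) - (v.sigmoid : ℂ) = ((v.sigmoid * Real.exp (-v) : ℝ) : ℂ) := by
    rw [← h1]; push_cast; rfl
  have h3 : ((v.sigmoid * Real.exp (-v) : ℝ) : ℂ) ≠ 0 := by
    exact_mod_cast (mul_pos hσ (Real.exp_pos _)).ne'
  simp only
  rw [sigmoid_mul_one_sub_eq, abs_of_nonneg (by positivity), h2,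
    Complex.cpow_def_of_ne_zero (by exact_mod_cast hσ.ne'), Complex.cpow_def_of_ne_zero h3,
    ← Complex.ofReal_log hσ.le, ← Complex.ofReal_log (by positivity),
    Real.log_mul hσ.ne' (Real.exp_pos _).ne', Real.log_exp, ← Complex.exp_add, Complex.real_smul,
    mul_comm]
  congr 2
  push_cast
  ring

theorem integrable_inv_cosh_add_cosh (u : ℝ) :
    Integrable fun v : ℝ => 1 / (Real.cosh u + Real.cosh v) := by
  refine (integrable_inv_one_add_cosh.const_mul 2).mono'
    (by fun_prop : Measurable _).aestronglyMeasurable (Eventually.of_forall fun v => ?_)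
  have h1 := Real.one_le_cosh u
  have h2 := Real.cosh_pos v
  have h3 := Real.cosh_pos u
  rw [Real.norm_of_nonneg (by positivity), mul_one_div, div_le_div_iff₀ (by positivity)
    (by positivity)]
  linarith

/-- `sinh u / (cosh u + cosh v)` is a difference of two translated sigmoids, so an integration by
parts reduces its Fourier transform to that of the logistic density. -/
theorem fourier_inv_cosh_add_cosh {τ : ℝ} (hτ : τ ≠ 0) {u : ℝ} (hu : 0 < u) :
    ∫ v : ℝ, Complex.exp (Complex.I * τ * v) * ((1 / (Real.cosh u + Real.cosh v) : ℝ) : ℂ) =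
      ((2 * Real.pi * Real.sin (τ * u) / (Real.sinh (Real.pi * τ) * Real.sinh u) : ℝ) : ℂ) := by
  set E : ℝ → ℂ := fun v => Complex.exp (Complex.I * τ * v) with hE
  set k : ℝ → ℝ := fun v => 1 / (2 * (1 + Real.cosh v)) with hk
  have hEm : Measurable E := by fun_prop
  have hEn : ∀ v, ‖E v‖ = 1 := fun v => by
    rw [hE]
    simp only
    rw [show Complex.I * τ * v = ((τ * v : ℝ) : ℂ) * Complex.I by push_cast; ring,
      Complex.norm_exp_ofReal_mul_I]
  have hEint : ∀ {g : ℝ → ℝ}, Integrable g → Integrable fun v => E v * (g v : ℂ) := fun hg =>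
    hg.ofReal.bdd_mul hEm.aestronglyMeasurable (Eventually.of_forall fun v => (hEn v).le)
  set D : ℝ → ℝ := fun v => Real.sinh u * (1 / (Real.cosh u + Real.cosh v)) with hD
  have hDint : Integrable D := (integrable_inv_cosh_add_cosh u).const_mul _
  have hDσ : ∀ v, D v = (v + u).sigmoid - (v - u).sigmoid := fun v => by
    rw [sigmoid_add_sub_sigmoid_sub, ← mul_one_div]
  have hDder : ∀ v, HasDerivAt D (k (v + u) - k (v - u)) v := fun v => by
    rw [funext hDσ]
    simp only [hk, ← sigmoid_mul_one_sub_eq]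
    exact ((Real.hasDerivAt_sigmoid (v + u)).comp_add_const v u).sub
      ((Real.hasDerivAt_sigmoid (v - u)).comp_sub_const v u)
  have hkint : Integrable k := integrable_inv_one_add_cosh
  have hEder : ∀ v, HasDerivAt E (Complex.I * τ * E v) v := fun v => by
    have h1 : HasDerivAt (fun v : ℝ => Complex.I * τ * (v : ℂ)) (Complex.I * τ * 1) v :=
      (HasDerivAt.ofReal_comp (hasDerivAt_id v)).const_mul _
    have := h1.cexp
    rw [mul_one, mul_comm (Complex.exp _)] at this
    exact this
  have h0 := integral_eq_zero_of_hasDerivAt_of_integrable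
    (f := fun v => E v * (D v : ℂ))
    (f' := fun v => Complex.I * τ * E v * (D v : ℂ) + E v * ((k (v + u) - k (v - u) : ℝ) : ℂ))
    (fun v => (hEder v).mul (hDder v).ofReal_comp)
    (by
      simp only [mul_assoc]
      exact (((hEint hDint).const_mul _).const_mul _).add
        (hEint ((hkint.comp_add_right u).sub (hkint.comp_sub_right u))))
    (hEint hDint)
  have hsh : ∀ c : ℝ, ∫ v, E v * (k (v + c) : ℂ) = E (-c) * ∫ v, E v * (k v : ℂ) := fun c => by
    rw [← integral_add_right_eq_self (fun v => E v * (k v : ℂ)) c, ← integral_const_mul]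
    refine integral_congr_ae (Eventually.of_forall fun v => ?_)
    simp only [hE]
    rw [← mul_assoc, ← Complex.exp_add]
    congr 2
    push_cast
    ring
  have hk' := fourier_inv_one_add_cosh hτ
  have hsplit : ∫ v, (Complex.I * τ * E v * (D v : ℂ) + E v * ((k (v + u) - k (v - u) : ℝ) : ℂ)) =
      Complex.I * τ * (∫ v, E v * (D v : ℂ)) + (E (-u) - E u) * ∫ v, E v * (k v : ℂ) := by
    rw [integral_add]
    · simp_rw [mul_assoc (Complex.I * (τ : ℂ)), integral_const_mul]
      congr 1
      have h1 := hsh u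
      have h2 := hsh (-u)
      rw [neg_neg] at h2
      rw [sub_mul, ← h1, ← h2, ← integral_sub (hEint (hkint.comp_add_right u))
        (hEint (hkint.comp_add_right (-u)))]
      refine integral_congr_ae (Eventually.of_forall fun v => ?_)
      simp only [sub_eq_add_neg]
      push_cast
      ring
    · simp only [mul_assoc]
      exact ((hEint hDint).const_mul _).const_mul _
    · exact hEint ((hkint.comp_add_right u).sub (hkint.comp_sub_right u))
  rw [hsplit, hk'] at h0
  have hEu : E (-u) - E u = -(2 * Complex.I * (Real.sin (τ * u) : ℂ)) := by
    simp only [hE]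
    rw [show Complex.I * τ * ((-u : ℝ) : ℂ) = -((τ * u : ℝ) : ℂ) * Complex.I by push_cast; ring,
      show Complex.I * τ * (u : ℂ) = ((τ * u : ℝ) : ℂ) * Complex.I by push_cast; ring,
      Complex.ofReal_sin, Complex.sin]
    linear_combination ((Complex.exp (-((τ * u : ℝ) : ℂ) * Complex.I)) -
      Complex.exp (((τ * u : ℝ) : ℂ) * Complex.I)) * Complex.I_mul_I
  have hDD : ∫ v, E v * (D v : ℂ) = (Real.sinh u : ℂ) *
      ∫ v, E v * ((1 / (Real.cosh u + Real.cosh v) : ℝ) : ℂ) := by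
    rw [← integral_const_mul]
    refine integral_congr_ae (Eventually.of_forall fun v => ?_)
    simp only [hD]
    push_cast
    ring
  rw [hEu, hDD] at h0
  have hs : ((Real.sinh (Real.pi * τ) : ℝ) : ℂ) ≠ 0 := by
    have : Real.sinh (Real.pi * τ) ≠ 0 := by
      rw [Ne, Real.sinh_eq_zero]
      exact mul_ne_zero Real.pi_ne_zero hτ
    exact_mod_cast this
  have hsu : ((Real.sinh u : ℝ) : ℂ) ≠ 0 := by exact_mod_cast (Real.sinh_pos_iff.mpr hu).ne'
  have hτc : (τ : ℂ) ≠ 0 := by exact_mod_cast hτ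
  generalize ∫ v, E v * ((1 / (Real.cosh u + Real.cosh v) : ℝ) : ℂ) = X at h0 ⊢
  rw [Complex.ofReal_div, Complex.ofReal_mul] at h0
  rw [Complex.ofReal_div, Complex.ofReal_mul (Real.sinh _), Complex.ofReal_mul,
    Complex.ofReal_mul, eq_div_iff (mul_ne_zero hs hsu)]
  have hdiv := div_mul_cancel₀ ((Real.pi : ℂ) * τ) hs
  refine mul_left_cancel₀ (mul_ne_zero Complex.I_ne_zero hτc) ?_
  push_cast at h0 hdiv ⊢
  linear_combination Complex.sinh (Real.pi * τ) * h0 +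
    2 * Complex.I * Complex.sin (τ * u) * hdiv

theorem integral_cos_div_cosh_add_cosh {τ : ℝ} (hτ : τ ≠ 0) {u : ℝ} (hu : 0 < u) :
    ∫ v in Ioi (0 : ℝ), Real.cos (τ * v) * (1 / (Real.cosh u + Real.cosh v)) =
      Real.pi * Real.sin (τ * u) / (Real.sinh (Real.pi * τ) * Real.sinh u) := by
  have h := fourier_inv_cosh_add_cosh hτ hu
  have h2 := congrArg Complex.re h
  have hint : Integrable fun v : ℝ => Complex.exp (Complex.I * τ * v) *
      ((1 / (Real.cosh u + Real.cosh v) : ℝ) : ℂ) := by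
    refine (integrable_inv_cosh_add_cosh u).ofReal.bdd_mul (c := 1)
      (by fun_prop : Measurable _).aestronglyMeasurable (Eventually.of_forall fun v => ?_)
    rw [show Complex.I * τ * v = ((τ * v : ℝ) : ℂ) * Complex.I by push_cast; ring,
      Complex.norm_exp_ofReal_mul_I]
  have h3 := integral_re hint
  simp only [RCLike.re_to_complex] at h3
  rw [← h3, Complex.ofReal_re] at h2
  have h4 := integral_comp_abs
    (f := fun v => Real.cos (τ * v) * (1 / (Real.cosh u + Real.cosh v)))
  rw [← mul_right_inj' (two_ne_zero' ℝ), ← h4, ← mul_div_assoc, ← mul_assoc, ← h2]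
  refine integral_congr_ae (Eventually.of_forall fun v => ?_)
  simp only
  rw [show Complex.I * τ * v = ((τ * v : ℝ) : ℂ) * Complex.I by push_cast; ring,
    Complex.re_mul_ofReal, Complex.exp_ofReal_mul_I_re, Real.cosh_abs]
  congr 1
  rw [← Real.cos_abs (τ * |v|), ← Real.cos_abs (τ * v), abs_mul, abs_mul, abs_abs]

/-! ### Injectivity of the Laplace transform -/

/-- Injectivity of the Laplace transform. After the substitution `x = e⁻ᵗ` the hypothesis says that
all moments vanish, and Weierstrass approximation passes from polynomials to test functions. -/
theorem eqOn_zero_of_laplace_eq_zero {h : ℝ → ℝ} (hc : ContinuousOn h (Ioi 0))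
    (hint : ∀ p : ℝ, 1 < p → IntegrableOn (fun t => h t * Real.exp (-(p * t))) (Ioi 0))
    (h0 : ∀ p : ℝ, 1 < p → ∫ t in Ioi (0 : ℝ), h t * Real.exp (-(p * t)) = 0) :
    EqOn h 0 (Ioi 0) := by
  set H : ℝ → ℝ := fun t => h t * Real.exp (-(2 * t)) with hH
  have hHint : IntegrableOn H (Ioi 0) := hint 2 (by norm_num)
  have hHc : ContinuousOn H (Ioi 0) := hc.mul (by fun_prop)
  have hpow : ∀ n : ℕ, IntegrableOn (fun t => H t * Real.exp (-t) ^ n) (Ioi 0) ∧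
      ∫ t in Ioi (0 : ℝ), H t * Real.exp (-t) ^ n = 0 := fun n => by
    have e : (fun t => H t * Real.exp (-t) ^ n) =
        fun t => h t * Real.exp (-((2 + n : ℝ) * t)) := by
      funext t
      rw [hH, ← Real.exp_nat_mul, mul_assoc, ← Real.exp_add]
      ring_nf
    have hn : (1 : ℝ) < 2 + n := by linarith [(Nat.cast_nonneg n : (0 : ℝ) ≤ n)]
    rw [e]
    exact ⟨hint _ hn, h0 _ hn⟩
  have hpoly : ∀ q : Polynomial ℝ, IntegrableOn (fun t => H t * q.eval (Real.exp (-t))) (Ioi 0) ∧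
      ∫ t in Ioi (0 : ℝ), H t * q.eval (Real.exp (-t)) = 0 := fun q => by
    have e : (fun t => H t * q.eval (Real.exp (-t))) =
        fun t => ∑ i ∈ Finset.range (q.natDegree + 1),
          q.coeff i * (H t * Real.exp (-t) ^ i) := by
      funext t
      rw [Polynomial.eval_eq_sum_range, Finset.mul_sum]
      exact Finset.sum_congr rfl fun i _ => by ring
    have hi : ∀ i ∈ Finset.range (q.natDegree + 1),
        IntegrableOn (fun t => q.coeff i * (H t * Real.exp (-t) ^ i)) (Ioi 0) :=
      fun i _ => (hpow i).1.const_mul _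
    rw [e]
    refine ⟨integrable_finsetSum _ hi, ?_⟩
    rw [integral_finsetSum _ hi]
    exact Finset.sum_eq_zero fun i _ => by rw [integral_const_mul, (hpow i).2, mul_zero]
  have hexp : ∀ t ∈ Ioi (0 : ℝ), Real.exp (-t) ∈ Icc (0 : ℝ) 1 := fun t ht =>
    ⟨(Real.exp_pos _).le, Real.exp_le_one_iff.mpr (by linarith [mem_Ioi.mp ht])⟩
  have hcont : ∀ φ : ℝ → ℝ, ContinuousOn φ (Icc 0 1) →
      ∫ t in Ioi (0 : ℝ), H t * φ (Real.exp (-t)) = 0 := fun φ hφ => by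
    set A := ∫ t in Ioi (0 : ℝ), ‖H t‖ with hA
    have hA0 : 0 ≤ A := integral_nonneg fun _ => norm_nonneg _
    obtain ⟨B, hB⟩ := isCompact_Icc.exists_bound_of_continuousOn hφ
    have hφint : IntegrableOn (fun t => H t * φ (Real.exp (-t))) (Ioi 0) := by
      refine (hHint.norm.mul_const B).mono' ?_ ?_
      · refine (hHc.mul (hφ.comp (by fun_prop) hexp)).aestronglyMeasurable measurableSet_Ioi
      · filter_upwards [ae_restrict_mem measurableSet_Ioi] with t ht
        rw [norm_mul]
        exact mul_le_mul_of_nonneg_left (hB _ (hexp t ht)) (norm_nonneg _)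
    refine norm_le_zero_iff.mp (le_of_forall_pos_le_add fun ε hε => ?_)
    obtain ⟨q, hq⟩ := exists_polynomial_near_of_continuousOn 0 1 φ hφ (ε / (A + 1))
      (by positivity)
    have e : ∫ t in Ioi (0 : ℝ), H t * φ (Real.exp (-t)) =
        -∫ t in Ioi (0 : ℝ), H t * (q.eval (Real.exp (-t)) - φ (Real.exp (-t))) := by
      simp_rw [mul_sub]
      rw [integral_sub (hpoly q).1 hφint, (hpoly q).2]
      ring
    rw [e, norm_neg, zero_add]
    calc _ ≤ ∫ t in Ioi (0 : ℝ), ‖H t‖ * (ε / (A + 1)) := by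
          refine norm_integral_le_of_norm_le (hHint.norm.mul_const _) ?_
          filter_upwards [ae_restrict_mem measurableSet_Ioi] with t ht
          rw [norm_mul]
          exact mul_le_mul_of_nonneg_left (hq _ (hexp t ht)).le (norm_nonneg _)
      _ = A / (A + 1) * ε := by rw [integral_mul_const, ← hA]; ring
      _ ≤ ε := mul_le_of_le_one_left hε.le ((div_le_one (by positivity)).mpr (by linarith))
  have hae : ∀ᵐ t, t ∈ Ioi (0 : ℝ) → H t = 0 := by
    refine isOpen_Ioi.ae_eq_zero_of_integral_contDiff_smul_eq_zero
      (hHc.locallyIntegrableOn measurableSet_Ioi) fun g hg hgc hgs => ?_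
    have hφ : ContinuousOn (fun x => g (-Real.log x)) (Icc 0 1) := by
      intro x hx
      rcases hx.1.eq_or_lt with rfl | hx0
      · obtain ⟨R, hR⟩ := hgc.isCompact.isBounded.exists_norm_le
        have hz : ∀ y, R < |y| → g y = 0 := fun y hy => by
          by_contra hne
          exact absurd (hR y (subset_tsupport g hne)) (not_le.mpr hy)
        have hg0 : g 0 = 0 := by
          by_contra hne
          exact lt_irrefl (0 : ℝ) (hgs (subset_tsupport g hne))
        refine continuousWithinAt_const (b := (0 : ℝ)) |>.congr_of_eventuallyEq ?_ (by simp [hg0])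
        filter_upwards [self_mem_nhdsWithin, mem_nhdsWithin_of_mem_nhds
          (Iio_mem_nhds (Real.exp_pos (-(|R| + 1))))] with x hx1 hx2
        rcases hx1.1.eq_or_lt with rfl | hx0
        · simp [hg0]
        · refine hz _ ?_
          have : Real.log x < -(|R| + 1) := (Real.log_lt_iff_lt_exp hx0).mpr hx2
          rw [abs_neg]
          have h1 := neg_abs_le (Real.log x)
          have h2 := le_abs_self R
          have h3 := neg_le_abs (Real.log x)
          linarith
      · exact (hg.continuous.continuousAt.comp
          (Real.continuousAt_log hx0.ne').neg).continuousWithinAt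
    have := hcont _ hφ
    rw [← this, ← integral_indicator measurableSet_Ioi]
    refine integral_congr_ae (Eventually.of_forall fun t => ?_)
    by_cases ht : t ∈ Ioi (0 : ℝ)
    · simp [indicator_of_mem ht, mul_comm]
    · have : g t = 0 := by
        by_contra hne
        exact ht (hgs (subset_tsupport g hne))
      simp [indicator_of_notMem ht, this]
  have heq : EqOn H 0 (Ioi 0) := by
    refine Measure.eqOn_open_of_ae_eq (μ := volume) ?_ isOpen_Ioi hHc continuousOn_const
    exact (ae_restrict_iff' measurableSet_Ioi).mpr hae
  intro t ht
  have := heq ht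
  simpa [hH, (Real.exp_pos _).ne'] using this

/-! ### The Macdonald function and the Stieltjes transform of the kernel -/

theorem aestronglyMeasurable_re_besselI (τ : ℝ) :
    AEStronglyMeasurable (fun t : ℝ => (besselI (Complex.I * τ) t).re)
      (volume.restrict (Ioi (0 : ℝ))) :=
  (Complex.continuous_re.comp_continuousOn
    (continuousOn_besselI τ)).aestronglyMeasurable measurableSet_Ioi

theorem integrableOn_besselI_mul_exp (τ : ℝ) {p : ℝ} (hp : 1 < p) :
    IntegrableOn (fun t : ℝ => besselI (Complex.I * τ) t * (Real.exp (-(p * t)) : ℂ)) (Ioi 0) := by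
  have h1 := (integrableOn_exp_mul_Ioi (a := 1 - p) (by linarith) 0).const_mul
    (√(Real.cosh (Real.pi * τ)))
  refine h1.mono' ?_ ?_
  · exact ((continuousOn_besselI τ).mul (by fun_prop)).aestronglyMeasurable measurableSet_Ioi
  · filter_upwards [ae_restrict_mem measurableSet_Ioi] with t ht
    rw [norm_mul, Complex.norm_real, Real.norm_of_nonneg (Real.exp_pos _).le,
      show (1 - p) * t = t + -(p * t) by ring, Real.exp_add, ← mul_assoc]
    exact mul_le_mul_of_nonneg_right (norm_besselI_le_exp τ ht) (Real.exp_pos _).le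

theorem exp_neg_I_mul_div_sinh (τ u : ℝ) :
    Complex.exp (-(Complex.I * τ * u)) / (Real.sinh u : ℂ) =
      ((Real.cos (τ * u) / Real.sinh u : ℝ) : ℂ) -
        ((Real.sin (τ * u) / Real.sinh u : ℝ) : ℂ) * Complex.I := by
  rw [show -(Complex.I * τ * u) = ((-(τ * u) : ℝ) : ℂ) * Complex.I by push_cast; ring,
    Complex.exp_mul_I, ← Complex.ofReal_cos, ← Complex.ofReal_sin, Real.cos_neg, Real.sin_neg]
  push_cast
  ring

theorem integral_re_besselI_mul_exp (τ : ℝ) {u : ℝ} (hu : 0 < u) :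
    ∫ t in Ioi (0 : ℝ), (besselI (Complex.I * τ) t).re * Real.exp (-(Real.cosh u * t)) =
      Real.cos (τ * u) / Real.sinh u := by
  have h := integral_re (integrableOn_besselI_mul_exp τ (Real.one_lt_cosh.mpr hu.ne'))
  simp only [RCLike.re_to_complex, Complex.re_mul_ofReal] at h
  rw [h, integral_besselI_mul_exp τ hu, exp_neg_I_mul_div_sinh, Complex.sub_re,
    Complex.ofReal_re, Complex.re_ofReal_mul, Complex.I_re, mul_zero, sub_zero]

theorem integral_im_besselI_mul_exp (τ : ℝ) {u : ℝ} (hu : 0 < u) :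
    ∫ t in Ioi (0 : ℝ), (besselI (Complex.I * τ) t).im * Real.exp (-(Real.cosh u * t)) =
      -(Real.sin (τ * u) / Real.sinh u) := by
  have h := integral_im (integrableOn_besselI_mul_exp τ (Real.one_lt_cosh.mpr hu.ne'))
  simp only [RCLike.im_to_complex, Complex.im_mul_ofReal] at h
  rw [h, integral_besselI_mul_exp τ hu, exp_neg_I_mul_div_sinh, Complex.sub_im,
    Complex.ofReal_im, Complex.im_ofReal_mul, Complex.I_im, mul_one, zero_sub]

/-- The integral `∫₀^∞ exp(-z cosh v) cos(τv) dv`, which represents `K_{iτ}(z)`. -/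
noncomputable def macdonaldIntegral (τ z : ℝ) : ℝ :=
  ∫ v in Ioi (0 : ℝ), Real.exp (-(z * Real.cosh v)) * Real.cos (τ * v)

theorem integrableOn_exp_neg_mul_cosh {z : ℝ} (hz : 0 < z) :
    IntegrableOn (fun v : ℝ => Real.exp (-(z * Real.cosh v))) (Ioi 0) := by
  refine (integrableOn_exp_mul_Ioi (a := -(z / 2)) (by linarith) 0).mono'
    (by fun_prop : Measurable _).aestronglyMeasurable (Eventually.of_forall fun v => ?_)
  rw [Real.norm_of_nonneg (Real.exp_pos _).le]
  refine Real.exp_le_exp.mpr ?_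
  have h : v / 2 ≤ Real.cosh v := by
    rw [Real.cosh_eq]
    linarith [Real.add_one_le_exp v, Real.exp_pos (-v)]
  nlinarith

theorem continuousOn_macdonaldIntegral (τ : ℝ) : ContinuousOn (macdonaldIntegral τ) (Ioi 0) := by
  intro z₀ hz₀
  refine ContinuousAt.continuousWithinAt ?_
  have hz₀' : 0 < z₀ / 2 := half_pos hz₀
  refine continuousAt_of_dominated (bound := fun v => Real.exp (-(z₀ / 2 * Real.cosh v)))
    ?_ ?_ (integrableOn_exp_neg_mul_cosh hz₀') ?_
  · exact Eventually.of_forall fun z => (by fun_prop : Measurable _).aestronglyMeasurable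
  · filter_upwards [Ioi_mem_nhds (half_lt_self hz₀)] with z hz
    refine Eventually.of_forall fun v => ?_
    rw [norm_mul, Real.norm_of_nonneg (Real.exp_pos _).le]
    refine (mul_le_of_le_one_right (Real.exp_pos _).le (Real.abs_cos_le_one _)).trans ?_
    refine Real.exp_le_exp.mpr (neg_le_neg ?_)
    have := Real.cosh_pos v
    have hz' : z₀ / 2 ≤ z := le_of_lt hz
    gcongr
  · exact Eventually.of_forall fun v => by fun_prop

theorem integral_exp_neg_mul_Ioi_zero {a : ℝ} (ha : 0 < a) :
    ∫ s in Ioi (0 : ℝ), Real.exp (-(a * s)) = 1 / a := by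
  have := integral_exp_mul_Ioi (a := -a) (by linarith) 0
  simp only [neg_mul] at this
  rw [this]
  simp

theorem integrableOn_exp_neg_mul_Ioi_zero {a : ℝ} (ha : 0 < a) :
    IntegrableOn (fun s : ℝ => Real.exp (-(a * s))) (Ioi 0) := by
  have := integrableOn_exp_mul_Ioi (a := -a) (by linarith) 0
  simpa only [neg_mul] using this

theorem integrable_uncurry_exp_mul_cos (τ : ℝ) {p : ℝ} (hp : 1 < p) :
    Integrable (Function.uncurry fun v t : ℝ =>
      Real.exp (-(t * Real.cosh v)) * Real.cos (τ * v) * Real.exp (-(p * t)))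
      ((volume.restrict (Ioi (0 : ℝ))).prod (volume.restrict (Ioi (0 : ℝ)))) := by
  obtain ⟨u, hu, rfl⟩ : ∃ u : ℝ, 0 < u ∧ Real.cosh u = p :=
    ⟨Real.arcosh p, Real.arcosh_pos hp, Real.cosh_arcosh hp.le⟩
  have hm : AEStronglyMeasurable (Function.uncurry fun v t : ℝ =>
      Real.exp (-(t * Real.cosh v)) * Real.cos (τ * v) * Real.exp (-(Real.cosh u * t)))
      ((volume.restrict (Ioi (0 : ℝ))).prod (volume.restrict (Ioi (0 : ℝ)))) := by
    unfold Function.uncurry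
    exact (by fun_prop : Measurable _).aestronglyMeasurable
  have hpos : ∀ v, 0 < Real.cosh u + Real.cosh v := fun v => by
    have := Real.cosh_pos u
    have := Real.cosh_pos v
    positivity
  have e : ∀ v t : ℝ, Real.exp (-(t * Real.cosh v)) * Real.cos (τ * v) *
      Real.exp (-(Real.cosh u * t)) =
      Real.cos (τ * v) * Real.exp (-((Real.cosh u + Real.cosh v) * t)) := fun v t => by
    rw [mul_right_comm, ← Real.exp_add, mul_comm]
    ring_nf
  refine (integrable_prod_iff hm).mpr ⟨Eventually.of_forall fun v => ?_, ?_⟩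
  · simp only [Function.uncurry_apply_pair, e]
    exact (integrableOn_exp_neg_mul_Ioi_zero (hpos v)).const_mul _
  · simp only [Function.uncurry_apply_pair, e, norm_mul, Real.norm_of_nonneg (Real.exp_pos _).le,
      integral_const_mul, integral_exp_neg_mul_Ioi_zero (hpos _)]
    refine ((integrable_inv_cosh_add_cosh u).integrableOn (s := Ioi 0)).mono'
      (by fun_prop : Measurable _).aestronglyMeasurable (Eventually.of_forall fun v => ?_)
    have := hpos v
    rw [norm_mul, norm_norm, Real.norm_of_nonneg (by positivity : 0 ≤
      1 / (Real.cosh u + Real.cosh v))]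
    exact mul_le_of_le_one_left (by positivity) (Real.abs_cos_le_one _)

theorem integrableOn_macdonaldIntegral_mul_exp (τ : ℝ) {p : ℝ} (hp : 1 < p) :
    IntegrableOn (fun t => macdonaldIntegral τ t * Real.exp (-(p * t))) (Ioi 0) := by
  have := (integrable_uncurry_exp_mul_cos τ hp).integral_prod_right
  simp only [Function.uncurry_apply_pair, integral_mul_const] at this
  exact this

theorem integral_macdonaldIntegral_mul_exp {τ : ℝ} (hτ : τ ≠ 0) {u : ℝ} (hu : 0 < u) :
    ∫ t in Ioi (0 : ℝ), macdonaldIntegral τ t * Real.exp (-(Real.cosh u * t)) =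
      Real.pi * Real.sin (τ * u) / (Real.sinh (Real.pi * τ) * Real.sinh u) := by
  have h := integral_integral_swap
    (integrable_uncurry_exp_mul_cos τ (Real.one_lt_cosh.mpr hu.ne'))
  simp only [integral_mul_const] at h
  rw [← integral_cos_div_cosh_add_cosh hτ hu]
  refine h.symm.trans (integral_congr_ae (Eventually.of_forall fun v => ?_))
  have hpos : 0 < Real.cosh u + Real.cosh v := by
    have := Real.cosh_pos u
    have := Real.cosh_pos v
    positivity
  simp only
  rw [← integral_exp_neg_mul_Ioi_zero hpos, ← integral_const_mul]
  refine integral_congr_ae (Eventually.of_forall fun t => ?_)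
  simp only
  rw [mul_right_comm, ← Real.exp_add, mul_comm]
  ring_nf

/-- `K_{iτ}` as an integral: both sides have the same Laplace transform. -/
theorem macdonaldIntegral_eq {τ : ℝ} (hτ : τ ≠ 0) {z : ℝ} (hz : 0 < z) :
    macdonaldIntegral τ z =
      -(Real.pi * (besselI (Complex.I * τ) z).im / Real.sinh (Real.pi * τ)) := by
  have hs : Real.sinh (Real.pi * τ) ≠ 0 := by
    rw [Ne, Real.sinh_eq_zero]
    exact mul_ne_zero Real.pi_ne_zero hτ
  have him : ∀ p : ℝ, 1 < p → IntegrableOn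
      (fun t : ℝ => (besselI (Complex.I * τ) t).im * Real.exp (-(p * t))) (Ioi 0) := fun p hp => by
    have := (integrableOn_besselI_mul_exp τ hp).im
    simp only [RCLike.im_to_complex, Complex.im_mul_ofReal] at this
    exact this
  have e : ∀ p t : ℝ, (macdonaldIntegral τ t +
      Real.pi / Real.sinh (Real.pi * τ) * (besselI (Complex.I * τ) t).im) * Real.exp (-(p * t)) =
      macdonaldIntegral τ t * Real.exp (-(p * t)) + Real.pi / Real.sinh (Real.pi * τ) *
        ((besselI (Complex.I * τ) t).im * Real.exp (-(p * t))) := fun p t => by ring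
  have h := eqOn_zero_of_laplace_eq_zero
    (h := fun t => macdonaldIntegral τ t +
      Real.pi / Real.sinh (Real.pi * τ) * (besselI (Complex.I * τ) t).im)
    ((continuousOn_macdonaldIntegral τ).add
      ((Complex.continuous_im.comp_continuousOn (continuousOn_besselI τ)).const_smul
        (Real.pi / Real.sinh (Real.pi * τ))))
    (fun p hp => by
      simp only [e]
      exact (integrableOn_macdonaldIntegral_mul_exp τ hp).add ((him p hp).const_mul _))
    (fun p hp => by
      simp only [e]
      rw [integral_add (integrableOn_macdonaldIntegral_mul_exp τ hp) ((him p hp).const_mul _),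
        integral_const_mul]
      obtain ⟨u, hu, rfl⟩ : ∃ u : ℝ, 0 < u ∧ Real.cosh u = p :=
        ⟨Real.arcosh p, Real.arcosh_pos hp, Real.cosh_arcosh hp.le⟩
      rw [integral_macdonaldIntegral_mul_exp hτ hu, integral_im_besselI_mul_exp τ hu]
      have := (Real.sinh_pos_iff.mpr hu).ne'
      field_simp
      ring)
  have := h hz
  simp only [Pi.zero_apply] at this
  rw [eq_neg_of_add_eq_zero_left this]
  ring

theorem besselI_neg_eq_conj (τ : ℝ) {t : ℝ} (ht : 0 < t) :
    besselI (-(Complex.I * τ)) t = (starRingEnd ℂ) (besselI (Complex.I * τ) t) := by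
  rw [besselI, besselI, Complex.conj_tsum]
  refine tsum_congr fun k => ?_
  have h2 : (t : ℂ) / 2 = ((t / 2 : ℝ) : ℂ) := by push_cast; rfl
  have hc := Complex.conj_cpow ((t / 2 : ℝ) : ℂ)
    ((starRingEnd ℂ) (2 * (k : ℂ) + Complex.I * τ)) (by
      rw [Complex.arg_ofReal_of_nonneg (by positivity)]
      exact Real.pi_pos.ne)
  rw [Complex.conj_conj, Complex.conj_ofReal] at hc
  rw [map_div₀, map_mul, ← Complex.Gamma_conj, h2, ← hc]
  simp [map_ofNat (starRingEnd ℂ) 2]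

/-- For `τ ≠ 0` the index `iτ` is no integer, so `K_{iτ}` is given by the quotient. -/
theorem besselK_eq_macdonaldIntegral {τ : ℝ} (hτ : τ ≠ 0) {z : ℝ} (hz : 0 < z) :
    besselK (Complex.I * τ) z = (macdonaldIntegral τ z : ℂ) := by
  have hs : Real.sinh (Real.pi * τ) ≠ 0 := by
    rw [Ne, Real.sinh_eq_zero]
    exact mul_ne_zero Real.pi_ne_zero hτ
  have hs' : ((Real.sinh (Real.pi * τ) : ℝ) : ℂ) ≠ 0 := by exact_mod_cast hs
  have hsin : Complex.sin (Real.pi * (Complex.I * τ)) =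
      (Real.sinh (Real.pi * τ) : ℂ) * Complex.I := by
    rw [show (Real.pi : ℂ) * (Complex.I * τ) = (Real.pi * τ : ℂ) * Complex.I by ring,
      Complex.sin_mul_I]
    push_cast; rfl
  have hne : Complex.sin (Real.pi * (Complex.I * τ)) ≠ 0 := by
    rw [hsin]
    exact mul_ne_zero hs' Complex.I_ne_zero
  rw [besselK, if_neg hne, besselKQuot, besselI_neg_eq_conj τ hz, macdonaldIntegral_eq hτ hz, hsin,
    ← neg_sub, Complex.sub_conj]
  push_cast at hs' ⊢
  field_simp

theorem integrableOn_rpow_div_add {z : ℝ} (hz : 0 < z) :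
    IntegrableOn (fun t : ℝ => t ^ (-(1 / 4) : ℝ) / (z + t)) (Ioi 0) := by
  rw [← Ioc_union_Ioi_eq_Ioi (zero_le_one' ℝ)]
  have hm : Measurable fun t : ℝ => t ^ (-(1 / 4) : ℝ) / (z + t) := by fun_prop
  refine IntegrableOn.union ?_ ?_
  · have h := intervalIntegral.intervalIntegrable_rpow' (a := 0) (b := 1)
      (r := (-(1 / 4) : ℝ)) (by norm_num)
    rw [intervalIntegrable_iff_integrableOn_Ioc_of_le zero_le_one] at h
    refine (h.div_const z).mono' hm.aestronglyMeasurable ?_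
    filter_upwards [ae_restrict_mem measurableSet_Ioc] with t ht
    have ht0 := ht.1
    rw [Real.norm_of_nonneg (by positivity)]
    gcongr
    linarith
  · refine (integrableOn_Ioi_rpow_of_lt (a := (-(5 / 4) : ℝ)) (c := 1) (by norm_num)
      one_pos).mono' hm.aestronglyMeasurable ?_
    filter_upwards [ae_restrict_mem measurableSet_Ioi] with t ht
    have ht0 : (0 : ℝ) < t := one_pos.trans ht
    rw [Real.norm_of_nonneg (by positivity),
      show (-(5 / 4) : ℝ) = -(1 / 4) - 1 by norm_num, Real.rpow_sub_one ht0.ne']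
    gcongr
    linarith

theorem integrableOn_re_besselI_div_add (τ : ℝ) {z : ℝ} (hz : 0 < z) :
    IntegrableOn (fun t : ℝ => (besselI (Complex.I * τ) t).re * Real.exp (-t) / (z + t))
      (Ioi 0) := by
  obtain ⟨C, hC, hb⟩ := exists_norm_besselI_le
  refine ((integrableOn_rpow_div_add hz).const_mul (√(Real.cosh (Real.pi * τ)) * C)).mono' ?_ ?_
  · exact ((aestronglyMeasurable_re_besselI τ).mul (by fun_prop : Measurable fun t : ℝ =>
      Real.exp (-t)).aestronglyMeasurable).div₀
      (by fun_prop : Measurable fun t : ℝ => z + t).aestronglyMeasurable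
  · filter_upwards [ae_restrict_mem measurableSet_Ioi] with t ht
    have ht0 : (0 : ℝ) < t := ht
    rw [norm_div, norm_mul, Real.norm_of_nonneg (Real.exp_pos _).le,
      Real.norm_of_nonneg (by positivity : 0 ≤ z + t), ← mul_div_assoc]
    refine div_le_div_of_nonneg_right ?_ (by positivity)
    calc ‖(besselI (Complex.I * τ) t).re‖ * Real.exp (-t) ≤
        √(Real.cosh (Real.pi * τ)) * (C * (t ^ (-(1 / 4) : ℝ) * Real.exp t)) * Real.exp (-t) := by
          gcongr
          exact (Complex.abs_re_le_norm _).trans (hb τ t ht)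
      _ = √(Real.cosh (Real.pi * τ)) * C * t ^ (-(1 / 4) : ℝ) *
          (Real.exp t * Real.exp (-t)) := by ring
      _ = _ := by rw [← Real.exp_add]; simp

theorem image_cosh_sub_one : (fun u : ℝ => Real.cosh u - 1) '' Ioi 0 = Ioi 0 := by
  ext s
  constructor
  · rintro ⟨u, hu, rfl⟩
    have := Real.one_lt_cosh.mpr (ne_of_gt (mem_Ioi.mp hu))
    simp only [mem_Ioi]
    linarith
  · intro hs
    have hs' : 1 < 1 + s := by linarith [mem_Ioi.mp hs]
    refine ⟨Real.arcosh (1 + s), Real.arcosh_pos hs', ?_⟩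
    simp only
    rw [Real.cosh_arcosh hs'.le]
    ring

/-- The Stieltjes transform of `e⁻ᵗ Re I_{iτ}(t)`: writing `1 / (z + t)` as a Laplace integral
makes it an iterated Laplace transform. -/
theorem integral_re_besselI_div_add (τ : ℝ) {z : ℝ} (hz : 0 < z) :
    ∫ t in Ioi (0 : ℝ), (besselI (Complex.I * τ) t).re * Real.exp (-t) / (z + t) =
      Real.exp z * macdonaldIntegral τ z := by
  have hpos : ∀ t ∈ Ioi (0 : ℝ), 0 < z + t := fun t ht => by
    have : (0 : ℝ) < t := ht
    positivity
  have hm : AEStronglyMeasurable (Function.uncurry fun t s : ℝ =>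
      (besselI (Complex.I * τ) t).re * Real.exp (-t) * Real.exp (-((z + t) * s)))
      ((volume.restrict (Ioi (0 : ℝ))).prod (volume.restrict (Ioi (0 : ℝ)))) := by
    refine ((aestronglyMeasurable_re_besselI τ).comp_fst.mul ?_).mul ?_
    · exact (by fun_prop : Measurable fun q : ℝ × ℝ => Real.exp (-q.1)).aestronglyMeasurable
    · exact (by fun_prop : Measurable fun q : ℝ × ℝ =>
        Real.exp (-((z + q.1) * q.2))).aestronglyMeasurable
  have hint : Integrable (Function.uncurry fun t s : ℝ =>
      (besselI (Complex.I * τ) t).re * Real.exp (-t) * Real.exp (-((z + t) * s)))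
      ((volume.restrict (Ioi (0 : ℝ))).prod (volume.restrict (Ioi (0 : ℝ)))) := by
    refine (integrable_prod_iff hm).mpr ⟨?_, ?_⟩
    · filter_upwards [ae_restrict_mem measurableSet_Ioi] with t ht
      simp only [Function.uncurry_apply_pair]
      exact (integrableOn_exp_neg_mul_Ioi_zero (hpos t ht)).const_mul _
    · refine (integrableOn_re_besselI_div_add τ hz).norm.congr ?_
      filter_upwards [ae_restrict_mem measurableSet_Ioi] with t ht
      simp only [Function.uncurry_apply_pair]
      simp_rw [norm_mul _ (Real.exp (-((z + t) * _))),
        Real.norm_of_nonneg (Real.exp_pos (-((z + t) * _))).le]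
      rw [integral_const_mul, integral_exp_neg_mul_Ioi_zero (hpos t ht), norm_div,
        Real.norm_of_nonneg (hpos t ht).le, mul_one_div]
  have h1 : ∫ t in Ioi (0 : ℝ), (besselI (Complex.I * τ) t).re * Real.exp (-t) / (z + t) =
      ∫ t in Ioi (0 : ℝ), ∫ s in Ioi (0 : ℝ),
        (besselI (Complex.I * τ) t).re * Real.exp (-t) * Real.exp (-((z + t) * s)) := by
    refine setIntegral_congr_fun measurableSet_Ioi fun t ht => ?_
    rw [integral_const_mul, integral_exp_neg_mul_Ioi_zero (hpos t ht), mul_one_div]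
  rw [h1, integral_integral_swap hint, macdonaldIntegral, ← integral_const_mul,
    ← image_cosh_sub_one, integral_image_eq_integral_abs_deriv_smul measurableSet_Ioi
      (fun u _ => ((Real.hasDerivAt_cosh u).sub_const 1).hasDerivWithinAt), image_cosh_sub_one]
  -- In the variable `1 + s = cosh u` the inner integral is `cos (τ u) / sinh u`, and `sinh u`
  -- cancels against the Jacobian.
  · refine setIntegral_congr_fun measurableSet_Ioi fun u hu => ?_
    have hsu := Real.sinh_pos_iff.mpr (mem_Ioi.mp hu)
    have h2 := integral_re_besselI_mul_exp τ (mem_Ioi.mp hu)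
    have e : ∀ t : ℝ, (besselI (Complex.I * τ) t).re * Real.exp (-t) *
        Real.exp (-((z + t) * (Real.cosh u - 1))) = Real.exp z * Real.exp (-(z * Real.cosh u)) *
        ((besselI (Complex.I * τ) t).re * Real.exp (-(Real.cosh u * t))) := fun t => by
      have : Real.exp (-t) * Real.exp (-((z + t) * (Real.cosh u - 1))) =
          Real.exp z * Real.exp (-(z * Real.cosh u)) * Real.exp (-(Real.cosh u * t)) := by
        rw [← Real.exp_add, ← Real.exp_add, ← Real.exp_add]
        congr 1
        ring
      rw [mul_assoc, this]
      ring
    simp only [e, integral_const_mul, h2, abs_of_pos hsu, smul_eq_mul]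
    field_simp
  · intro u hu v hv huv
    have : Real.cosh u = Real.cosh v := by simpa using huv
    exact Real.cosh_injOn (Ioi_subset_Ici_self hu) (Ioi_subset_Ici_self hv) this

/-! ### The index transform -/

/-- The density `cosh(πτ)^(-1/2)` of `coshMeasure`. -/
noncomputable def coshWeight (τ : ℝ) : ℝ := Real.cosh (Real.pi * τ) ^ (-(1 / 2) : ℝ)

theorem coshWeight_pos (τ : ℝ) : 0 < coshWeight τ := Real.rpow_pos_of_pos (Real.cosh_pos _) _

theorem measurable_coshWeight : Measurable coshWeight := by unfold coshWeight; fun_prop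

theorem coshWeight_eq (τ : ℝ) : coshWeight τ = 1 / √(Real.cosh (Real.pi * τ)) := by
  rw [coshWeight, Real.rpow_neg (Real.cosh_pos _).le, Real.sqrt_eq_rpow, inv_eq_one_div]

theorem sqrt_cosh_div_cosh (τ : ℝ) :
    √(Real.cosh (Real.pi * τ)) / Real.cosh (Real.pi * τ) = coshWeight τ := by
  rw [coshWeight_eq, Real.sqrt_div_self']

theorem integrable_coshMeasure_iff {E : Type*} [NormedAddCommGroup E] [NormedSpace ℝ E]
    {g : ℝ → E} :
    Integrable g coshMeasure ↔ Integrable fun τ => coshWeight τ • g τ := by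
  have h := integrable_withDensity_iff_integrable_smul' (μ := (volume : Measure ℝ)) (g := g)
    measurable_coshWeight.ennreal_ofReal (by simp)
  simp only [ENNReal.toReal_ofReal (coshWeight_pos _).le] at h
  exact h

theorem integral_norm_coshMeasure (g : ℝ → ℂ) :
    ∫ τ, ‖g τ‖ ∂coshMeasure = ∫ τ, coshWeight τ * ‖g τ‖ := by
  have h := integral_withDensity_eq_integral_toReal_smul (μ := (volume : Measure ℝ))
    measurable_coshWeight.ennreal_ofReal (by simp) (fun τ => ‖g τ‖)
  simp only [ENNReal.toReal_ofReal (coshWeight_pos _).le, smul_eq_mul] at h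
  exact h

theorem volume_absolutelyContinuous_coshMeasure : (volume : Measure ℝ) ≪ coshMeasure := by
  refine withDensity_absolutelyContinuous' measurable_coshWeight.ennreal_ofReal.aemeasurable
    (Eventually.of_forall fun τ => ?_)
  exact (ENNReal.ofReal_pos.mpr (coshWeight_pos τ)).ne'

theorem integrable_coshWeight_mul_norm {g : ℝ → ℂ} (hg : Integrable g coshMeasure) :
    Integrable fun τ => coshWeight τ * ‖g τ‖ := by
  simpa using integrable_coshMeasure_iff.mp hg.norm

theorem aestronglyMeasurable_of_coshMeasure {g : ℝ → ℂ} (hg : Integrable g coshMeasure) :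
    AEStronglyMeasurable g volume :=
  hg.aestronglyMeasurable.mono_ac volume_absolutelyContinuous_coshMeasure

theorem norm_indexIntegrand (g : ℝ → ℂ) (x τ : ℝ) :
    ‖indexIntegrand g x τ‖ = |(besselI (Complex.I * τ) ((x / 2 : ℝ) : ℂ)).re| * ‖g τ‖ /
      Real.cosh (Real.pi * τ) := by
  rw [indexIntegrand, norm_div, norm_mul, Complex.norm_real, Complex.norm_real, Real.norm_eq_abs,
    Real.norm_of_nonneg (Real.cosh_pos _).le]

theorem norm_indexIntegrand_le_of {A x τ : ℝ} (g : ℝ → ℂ)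
    (h : ‖besselI (Complex.I * τ) ((x / 2 : ℝ) : ℂ)‖ ≤ √(Real.cosh (Real.pi * τ)) * A) :
    ‖indexIntegrand g x τ‖ ≤ A * (coshWeight τ * ‖g τ‖) := by
  rw [norm_indexIntegrand, ← sqrt_cosh_div_cosh]
  have hc := Real.cosh_pos (Real.pi * τ)
  have h1 := (Complex.abs_re_le_norm _).trans h
  calc _ ≤ √(Real.cosh (Real.pi * τ)) * A * ‖g τ‖ / Real.cosh (Real.pi * τ) := by gcongr
    _ = _ := by ring

theorem norm_indexIntegrand_le (g : ℝ → ℂ) {x : ℝ} (hx : 0 < x) (τ : ℝ) :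
    ‖indexIntegrand g x τ‖ ≤ Real.exp (x / 2) * (coshWeight τ * ‖g τ‖) :=
  norm_indexIntegrand_le_of g (norm_besselI_le_exp τ (half_pos hx))

theorem aestronglyMeasurable_indexIntegrand {g : ℝ → ℂ} (hg : AEStronglyMeasurable g volume)
    {x : ℝ} (hx : 0 < x) : AEStronglyMeasurable (indexIntegrand g x) volume := by
  obtain ⟨B, hB, h⟩ := exists_measurable_eq_besselI
  have e : indexIntegrand g x = fun τ => ((B (τ, x / 2)).re : ℂ) * g τ *
      ((Real.cosh (Real.pi * τ) : ℂ))⁻¹ := by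
    funext τ
    rw [h τ _ (half_pos hx), indexIntegrand, div_eq_mul_inv]
  rw [e]
  refine (AEStronglyMeasurable.mul ?_ hg).mul ?_
  · exact (Complex.measurable_ofReal.comp (Complex.measurable_re.comp
      (hB.comp (by fun_prop)))).aestronglyMeasurable
  · exact (by fun_prop : Measurable _).aestronglyMeasurable

theorem integrable_indexIntegrand {g : ℝ → ℂ} (hg : Integrable g coshMeasure)
    {x : ℝ} (hx : 0 < x) : Integrable (indexIntegrand g x) :=
  ((integrable_coshWeight_mul_norm hg).const_mul (Real.exp (x / 2))).mono'
    (aestronglyMeasurable_indexIntegrand (aestronglyMeasurable_of_coshMeasure hg) hx)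
    (Eventually.of_forall (norm_indexIntegrand_le g hx))

theorem norm_indexG_le {g : ℝ → ℂ} (hg : Integrable g coshMeasure) {x : ℝ} (hx : 0 < x) :
    ‖indexG g x‖ ≤ √Real.pi * ∫ τ, ‖g τ‖ ∂coshMeasure := by
  rw [indexG, norm_mul, Complex.norm_real, Real.norm_of_nonneg (by positivity),
    integral_norm_coshMeasure, mul_assoc]
  gcongr
  have h := norm_integral_le_of_norm_le
    ((integrable_coshWeight_mul_norm hg).const_mul (Real.exp (x / 2)))
    (Eventually.of_forall (norm_indexIntegrand_le g hx))
  rw [integral_const_mul] at h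
  calc _ ≤ Real.exp (-x / 2) *
        (Real.exp (x / 2) * ∫ τ, coshWeight τ * ‖g τ‖) := by gcongr
    _ = _ := by rw [← mul_assoc, ← Real.exp_add, neg_div, neg_add_cancel, Real.exp_zero, one_mul]

theorem continuousOn_indexG {g : ℝ → ℂ} (hg : Integrable g coshMeasure) :
    ContinuousOn (indexG g) (Ioi 0) := by
  refine ContinuousOn.mul (by fun_prop) fun x₀ hx₀ => ContinuousAt.continuousWithinAt ?_
  refine continuousAt_of_dominated
    (bound := fun τ => Real.exp ((x₀ + 1) / 2) * (coshWeight τ * ‖g τ‖)) ?_ ?_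
    ((integrable_coshWeight_mul_norm hg).const_mul _) ?_
  · filter_upwards [Ioi_mem_nhds hx₀] with x hx
    exact (integrable_indexIntegrand hg hx).aestronglyMeasurable
  · filter_upwards [Ioi_mem_nhds hx₀, Iio_mem_nhds (lt_add_one x₀)] with x hx hx1
    refine Eventually.of_forall fun τ => (norm_indexIntegrand_le g hx τ).trans ?_
    have := (coshWeight_pos τ).le
    have hx1' : x ≤ x₀ + 1 := le_of_lt hx1
    gcongr
  · refine Eventually.of_forall fun τ => ?_
    have h1 : ContinuousAt (fun x : ℝ => besselI (Complex.I * τ) ((x / 2 : ℝ) : ℂ)) x₀ :=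
      ContinuousAt.comp (f := fun x : ℝ => x / 2)
        (g := fun t : ℝ => besselI (Complex.I * τ) (t : ℂ))
        ((continuousOn_besselI τ).continuousAt (Ioi_mem_nhds (half_pos hx₀))) (by fun_prop)
    unfold indexIntegrand
    fun_prop

theorem indexG_congr_ae {f g : ℝ → ℂ} (h : f =ᵐ[coshMeasure] g) (x : ℝ) :
    indexG f x = indexG g x := by
  unfold indexG
  congr 1
  refine integral_congr_ae ?_
  filter_upwards [volume_absolutelyContinuous_coshMeasure.ae_le h] with τ hτ
  rw [indexIntegrand, indexIntegrand, hτ]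

theorem indexG_add {f g : ℝ → ℂ} (hf : Integrable f coshMeasure) (hg : Integrable g coshMeasure)
    {x : ℝ} (hx : 0 < x) : indexG (f + g) x = indexG f x + indexG g x := by
  rw [indexG, indexG, indexG, ← mul_add,
    ← integral_add (integrable_indexIntegrand hf hx) (integrable_indexIntegrand hg hx)]
  congr 2
  funext τ
  simp only [indexIntegrand, Pi.add_apply]
  ring

theorem indexG_smul (c : ℂ) (g : ℝ → ℂ) (x : ℝ) : indexG (c • g) x = c * indexG g x := by
  rw [indexG, indexG, mul_left_comm, ← integral_const_mul c]
  congr 2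
  funext τ
  simp only [indexIntegrand, Pi.smul_apply, smul_eq_mul]
  ring

/-- The index transform as a bounded operator from `L₁(ℝ; cosh(πτ)^(-1/2) dτ)` to the bounded
continuous functions on the half-line. -/
noncomputable def indexTransform : (ℝ →₁[coshMeasure] ℂ) →L[ℂ] (Ioi (0 : ℝ) →ᵇ ℂ) :=
  LinearMap.mkContinuous
    { toFun := fun f => BoundedContinuousFunction.ofNormedAddCommGroup
        (fun x : Ioi (0 : ℝ) => indexG f x)
        (continuousOn_iff_continuous_domRestrict.mp (continuousOn_indexG (L1.integrable_coeFn f)))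
        (√Real.pi * ∫ τ, ‖f τ‖ ∂coshMeasure)
        (fun x => norm_indexG_le (L1.integrable_coeFn f) x.2)
      map_add' := fun f g => by
        ext x
        exact (indexG_congr_ae (Lp.coeFn_add f g) x).trans
          (indexG_add (L1.integrable_coeFn f) (L1.integrable_coeFn g) x.2)
      map_smul' := fun c f => by
        ext x
        exact (indexG_congr_ae (Lp.coeFn_smul c f) x).trans (indexG_smul c f x) }
    (√Real.pi) fun f => by
      rw [L1.norm_eq_integral_norm]
      exact BoundedContinuousFunction.norm_ofNormedAddCommGroup_le _
        (mul_nonneg (Real.sqrt_nonneg _) (integral_nonneg fun _ => norm_nonneg _))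
        (fun x => norm_indexG_le (L1.integrable_coeFn f) x.2)

theorem integral_re_besselI_half_div_add (τ : ℝ) {x : ℝ} (hx : 0 < x) :
    ∫ t in Ioi (0 : ℝ), (besselI (Complex.I * τ) ((t / 2 : ℝ) : ℂ)).re *
      Real.exp (-t / 2) / (x + t) = Real.exp (x / 2) * macdonaldIntegral τ (x / 2) := by
  have h := integral_comp_mul_left_Ioi
    (fun s => (besselI (Complex.I * τ) s).re * Real.exp (-s) / (x / 2 + s)) 0
    (show (0 : ℝ) < 1 / 2 by norm_num)
  rw [mul_zero, integral_re_besselI_div_add τ (half_pos hx), smul_eq_mul] at h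
  have h' : ∀ t : ℝ, (besselI (Complex.I * τ) ((t / 2 : ℝ) : ℂ)).re *
      Real.exp (-t / 2) / (x + t) = 2⁻¹ * ((besselI (Complex.I * τ) ((1 / 2 * t : ℝ) : ℂ)).re *
        Real.exp (-(1 / 2 * t)) / (x / 2 + 1 / 2 * t)) := fun t => by
    rw [show 1 / 2 * t = t / 2 by ring, show x / 2 + t / 2 = (x + t) / 2 by ring,
      show -t / 2 = -(t / 2) by ring, div_div_eq_mul_div]
    ring
  simp_rw [h', integral_const_mul, h]
  norm_num
  ring

/-- Absolute convergence of the double integral behind the Stieltjes transform of `Gg`. -/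
theorem integrable_uncurry_indexIntegrand_div_add {g : ℝ → ℂ} (hg : Integrable g coshMeasure)
    {x : ℝ} (hx : 0 < x) :
    Integrable (Function.uncurry fun t τ : ℝ =>
      ((√Real.pi * Real.exp (-t / 2) / (x + t) : ℝ) : ℂ) * indexIntegrand g t τ)
      ((volume.restrict (Ioi (0 : ℝ))).prod volume) := by
  obtain ⟨B, hB, hBeq⟩ := exists_measurable_eq_besselI
  obtain ⟨C, hC, hb⟩ := exists_norm_besselI_le
  have hpos : ∀ᵐ q : ℝ × ℝ ∂((volume.restrict (Ioi (0 : ℝ))).prod volume), q.1 ∈ Ioi (0 : ℝ) :=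
    Measure.quasiMeasurePreserving_fst.ae (ae_restrict_mem measurableSet_Ioi)
  have hm : AEStronglyMeasurable (Function.uncurry fun t τ : ℝ =>
      ((√Real.pi * Real.exp (-t / 2) / (x + t) : ℝ) : ℂ) * indexIntegrand g t τ)
      ((volume.restrict (Ioi (0 : ℝ))).prod volume) := by
    have h1 : AEStronglyMeasurable (fun q : ℝ × ℝ =>
        ((√Real.pi * Real.exp (-q.1 / 2) / (x + q.1) : ℝ) : ℂ) *
          (((B (q.2, q.1 / 2)).re : ℂ) * g q.2 * ((Real.cosh (Real.pi * q.2) : ℂ))⁻¹))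
        ((volume.restrict (Ioi (0 : ℝ))).prod volume) := by
      refine AEStronglyMeasurable.mul ?_ (AEStronglyMeasurable.mul (AEStronglyMeasurable.mul ?_
        (aestronglyMeasurable_of_coshMeasure hg).comp_snd) ?_)
      · exact (by fun_prop : Measurable _).aestronglyMeasurable
      · exact (Complex.measurable_ofReal.comp (Complex.measurable_re.comp
          (hB.comp (by fun_prop)))).aestronglyMeasurable
      · exact (by fun_prop : Measurable _).aestronglyMeasurable
    refine h1.congr ?_
    filter_upwards [hpos] with q hq
    rw [hBeq _ _ (half_pos hq)]
    rfl
  have hbd := ((integrableOn_rpow_div_add hx).const_mul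
    (√Real.pi * (C * 2 ^ (1 / 4 : ℝ)))).mul_prod (integrable_coshWeight_mul_norm hg)
  refine hbd.mono' hm ?_
  filter_upwards [hpos] with q hq
  obtain ⟨t, τ⟩ := q
  have ht : (0 : ℝ) < t := hq
  have hw := (coshWeight_pos τ).le
  have h1 := norm_indexIntegrand_le_of g (hb τ (t / 2) (half_pos ht))
  simp only [Function.uncurry_apply_pair]
  rw [norm_mul, Complex.norm_real, Real.norm_of_nonneg (by positivity)]
  have h2 : (t / 2) ^ (-(1 / 4) : ℝ) = 2 ^ (1 / 4 : ℝ) * t ^ (-(1 / 4) : ℝ) := by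
    rw [Real.div_rpow ht.le (by norm_num), Real.rpow_neg (show (0 : ℝ) ≤ 2 by norm_num),
      div_inv_eq_mul, mul_comm]
  have h3 : Real.exp (-t / 2) * Real.exp (t / 2) = 1 := by
    rw [← Real.exp_add, neg_div, neg_add_cancel, Real.exp_zero]
  calc _ ≤ √Real.pi * Real.exp (-t / 2) / (x + t) *
        (C * ((t / 2) ^ (-(1 / 4) : ℝ) * Real.exp (t / 2)) * (coshWeight τ * ‖g τ‖)) := by gcongr
    _ = (Real.exp (-t / 2) * Real.exp (t / 2)) * (√Real.pi * (C * 2 ^ (1 / 4 : ℝ)) *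
        (t ^ (-(1 / 4) : ℝ) / (x + t)) * (coshWeight τ * ‖g τ‖)) := by rw [h2]; ring
    _ = _ := by rw [h3, one_mul]

theorem integral_indexIntegrand_div_add (g : ℝ → ℂ) {x : ℝ} (hx : 0 < x) {τ : ℝ} (hτ : τ ≠ 0) :
    ∫ t in Ioi (0 : ℝ),
      ((√Real.pi * Real.exp (-t / 2) / (x + t) : ℝ) : ℂ) * indexIntegrand g t τ =
    ((√Real.pi * Real.exp (x / 2) : ℝ) : ℂ) * macdonaldIntegrand g x τ := by
  rw [macdonaldIntegrand, besselK_eq_macdonaldIntegral hτ (half_pos hx)]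
  have h := congrArg (fun r : ℝ => (r : ℂ)) (integral_re_besselI_half_div_add τ hx)
  simp only [← integral_complex_ofReal] at h
  have e : ∀ t : ℝ, ((√Real.pi * Real.exp (-t / 2) / (x + t) : ℝ) : ℂ) * indexIntegrand g t τ =
      ((√Real.pi : ℝ) : ℂ) * g τ / ((Real.cosh (Real.pi * τ) : ℝ) : ℂ) *
        (((besselI (Complex.I * τ) ((t / 2 : ℝ) : ℂ)).re * Real.exp (-t / 2) / (x + t) : ℝ) : ℂ) :=
    fun t => by
      rw [indexIntegrand]
      push_cast
      ring
  simp_rw [e]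
  rw [integral_const_mul, h]
  push_cast
  ring

/-- The Stieltjes transform of `Gg`, for every `g` in the weighted `L₁` space: the double integral
converges absolutely without any further condition on `Gg`. -/
theorem stieltjes_indexG {g : ℝ → ℂ} (hg : Integrable g coshMeasure) {x : ℝ} (hx : 0 < x) :
    IntegrableOn (fun t : ℝ => indexG g t / ((x + t : ℝ) : ℂ)) (Ioi (0 : ℝ)) ∧
      Integrable (macdonaldIntegrand g x) ∧
      ∫ t in Ioi (0 : ℝ), indexG g t / ((x + t : ℝ) : ℂ) =
        ((√Real.pi * Real.exp (x / 2) : ℝ) : ℂ) * ∫ τ : ℝ, macdonaldIntegrand g x τ := by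
  have hint := integrable_uncurry_indexIntegrand_div_add hg hx
  have hG : ∀ t : ℝ, indexG g t / ((x + t : ℝ) : ℂ) = ∫ τ,
      ((√Real.pi * Real.exp (-t / 2) / (x + t) : ℝ) : ℂ) * indexIntegrand g t τ := fun t => by
    rw [integral_const_mul, indexG]
    push_cast
    ring
  have hK : (fun τ => ∫ t in Ioi (0 : ℝ),
      ((√Real.pi * Real.exp (-t / 2) / (x + t) : ℝ) : ℂ) * indexIntegrand g t τ) =ᵐ[volume]
      fun τ => ((√Real.pi * Real.exp (x / 2) : ℝ) : ℂ) * macdonaldIntegrand g x τ := by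
    filter_upwards [Measure.ae_ne volume (0 : ℝ)] with τ hτ
    exact integral_indexIntegrand_div_add g hx hτ
  have hc : ((√Real.pi * Real.exp (x / 2) : ℝ) : ℂ) ≠ 0 := by
    have : √Real.pi * Real.exp (x / 2) ≠ 0 := by positivity
    exact_mod_cast this
  refine ⟨?_, ?_, ?_⟩
  · simp_rw [hG]
    exact hint.integral_prod_left
  · exact (integrable_const_mul_iff hc.isUnit _).mp (hint.integral_prod_right.congr hK)
  · simp_rw [hG]
    rw [integral_integral_swap hint, integral_congr_ae hK, integral_const_mul]

theorem theorem3 :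
    -- the integral defining the transform converges absolutely
    (∀ g : ℝ → ℂ, Integrable g coshMeasure → ∀ x : ℝ, 0 < x → Integrable (indexIntegrand g x)) ∧
    -- bounded operator from the weighted L₁ space to bounded continuous functions on (0,∞)
    (∃ T : (ℝ →₁[coshMeasure] ℂ) →L[ℂ] (Ioi (0 : ℝ) →ᵇ ℂ),
      (∀ (g : ℝ → ℂ) (hg : Integrable g coshMeasure) (x : Ioi (0 : ℝ)),
        T (hg.toL1 g) x = indexG g (x : ℝ)) ∧
      ‖T‖ ≤ Real.sqrt Real.pi) ∧
    -- the Stieltjes transform of Gg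
    (∀ g : ℝ → ℂ, Integrable g coshMeasure →
      ∀ ν : ℝ, 0 < ν → ν < 1 / 2 → MemMellinLp ν 1 (indexG g) →
      ∀ x : ℝ, 0 < x →
        IntegrableOn (fun t : ℝ => indexG g t / ((x + t : ℝ) : ℂ)) (Ioi (0 : ℝ)) ∧
        Integrable (macdonaldIntegrand g x) ∧
        ∫ t in Ioi (0 : ℝ), indexG g t / ((x + t : ℝ) : ℂ) =
          ((Real.sqrt Real.pi * Real.exp (x / 2) : ℝ) : ℂ) *
            ∫ τ : ℝ, macdonaldIntegrand g x τ) :=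
  ⟨fun _ hg _ hx => integrable_indexIntegrand hg hx,
    ⟨indexTransform, fun _ hg x => indexG_congr_ae hg.coeFn_toL1 x,
      LinearMap.mkContinuous_norm_le _ (Real.sqrt_nonneg _) _⟩,
    fun _ hg _ _ _ _ _ hx => stieltjes_indexG hg hx⟩
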